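/- Let $\alpha>1$, let $a(t)=t^{\alpha}$ for $t>0$, let $k\in\{0,-1\}$ and $S_0(\chi)=\chi$, $S_{-1}(\chi)=\sinh\chi$. Consider the Robertson–Walker spacetime (with $d$ spatial dimensions; $d=3$ is the physical case and $d=1$ the two-dimensional radial spacetime $-dt^2+a(t)^2d\chi^2$) with metric $$ds^2=-dt^2+a(t)^2\bigl(d\chi^2+S_k(\chi)^2\,d\Omega^2\bigr),\qquad t>0,$$ and the comoving observer $\beta(\tau)=(\tau,0)$ at $\chi=0$. Let $e_1,\dots,e_d$ be any orthonormal frame of $\dot\beta^{\perp}$ that is parallel along $\beta$. Say that $(\tau,y)\in(0,\infty)\times(\mathbb R^d\setminus\{0\})$ are Fermi coordinates of an event $q$ if $\exp_{\beta(\tau)}\bigl(\sum_i y^ie_i(\tau)\bigr)$ is defined and equal to $q$; then $\rho=|y|>0$ is the proper length of this spacelike geodesic, which is orthogonal to $\beta$. Put $$\chi_{\mathrm{horiz}}(t)=\int_t^\infty\frac{ds}{a(s)},\qquad \rho_{\mathcal M_\tau}=\int_0^\tau\frac{a(t)}{\sqrt{a(\tau)^2-a(t)^2}}\,dt,$$ $$\mathcal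 V=\{(t,\chi): t>0,\ 0<\chi<\chi_{\mathrm{horiz}}(t)\},\qquad \mathcal U_{\mathrm{Fermi}}=\{(\tau,\rho): \tau>0,\ 0<\rho<\rho_{\mathcal M_\tau}\}.$$ Theorem. Fermi coordinates define a $C^\infty$ diffeomorphism $\Phi$ from the set of all events whose curvature coordinates $(t,\chi)$ lie in $\mathcal V$ onto the set of all $(\tau,y)$ with $(\tau,|y|)\in\mathcal U_{\mathrm{Fermi}}$. This chart is maximal: if $(\tau,y)$ with $\tau>0$, $y\neq0$ are Fermi coordinates of an event $q$, then $q$ lies in the domain of $\Phi$ and $(\tau,y)=\Phi(q)$; in particular every chart (diffeomorphism from an open set of events onto an open set) that assigns to each event Fermi coordinates of it, off the observer's world line, is a restriction of $\Phi$. Thus the maximal domain of the Fermi coordinates is the set of events with $(t,\chi)\in\mathcal V$, i.e. they extend up to the cosmological event horizon, and the range of $(\tau,\rho)$ is $\mathcal U_{\mathrm{Fermi}}$ (for $d\ge1$). -/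

import Mathlib

open Set MeasureTheory
open scoped ContDiff

namespace RW

noncomputable section

/-- Space with `d` spatial dimensions, in the quasi-Cartesian coordinates `x = S_k(χ) n`,
where `χ` is the radial curvature coordinate and `n` is the unit vector of angular coordinates. -/
abbrev Space (d : ℕ) : Type := EuclideanSpace ℝ (Fin d)

/-- Coordinates `(t, x)` of an event; also the coordinate components of tangent vectors.
The spacetime is the region `0 < t`. -/
abbrev Event (d : ℕ) : Type := ℝ × Space d

/-- The radial function `S_k` of the Robertson-Walker line element, for `k = 1, 0, -1`. -/
def radial (k χ : ℝ) : ℝ :=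
  if k = 1 then Real.sin χ else if k = 0 then χ else Real.sinh χ

/-- The spatial metric `|dx|² + k (x ⬝ dx)² / (1 - k |x|²)` of constant curvature `k`, polarized.
In the coordinates `x = S_k(χ) n` it is `dχ² + S_k(χ)² dΩ²`, see `spatialMetric_polar`. -/
def spatialMetric {d : ℕ} (k : ℝ) (x u v : Space d) : ℝ :=
  inner ℝ u v + k * (inner ℝ x u * inner ℝ x v) / (1 - k * ‖x‖ ^ 2)

/-- For `x = S_k(χ) n` with `|n| = 1`, the velocity `ẋ = C χ̇ n + S_k(χ) ṅ` with `C = dS_k/dχ`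
has square length `χ̇² + S_k(χ)² |ṅ|²`. -/
theorem spatialMetric_polar {d : ℕ} (k : ℝ) (hk : k = 0 ∨ k = -1) (χ C χ' : ℝ)
    (hC : HasDerivAt (radial k) C χ) (n n' : Space d) (hn : ‖n‖ = 1) (hnn : inner ℝ n n' = 0) :
    spatialMetric k (radial k χ • n) ((C * χ') • n + radial k χ • n')
      ((C * χ') • n + radial k χ • n') = χ' ^ 2 + radial k χ ^ 2 * ‖n'‖ ^ 2 := by
  have h1 : inner ℝ n n = (1 : ℝ) := by rw [real_inner_self_eq_norm_sq, hn]; norm_num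
  have h2 : inner ℝ n' n = (0 : ℝ) := by rw [real_inner_comm]; exact hnn
  have h3 : inner ℝ n' n' = ‖n'‖ ^ 2 := real_inner_self_eq_norm_sq n'
  have h4 : ‖radial k χ • n‖ ^ 2 = radial k χ ^ 2 := by
    rw [norm_smul, hn, mul_one, Real.norm_eq_abs, sq_abs]
  simp only [spatialMetric, h4, inner_add_left, inner_add_right, real_inner_smul_left,
    real_inner_smul_right, h1, h2, h3, hnn]
  rcases hk with rfl | rfl
  · have : radial 0 = id := by funext χ; simp [radial]
    rw [this] at hC
    have hC1 : C = 1 := hC.unique (hasDerivAt_id χ)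
    subst hC1; simp; ring
  · have : radial (-1) = Real.sinh := by funext χ; norm_num [radial]
    rw [this] at hC ⊢
    have hC1 : C = Real.cosh χ := hC.unique (Real.hasDerivAt_sinh χ)
    have hc := Real.cosh_sq χ
    have hp := Real.cosh_pos χ
    subst hC1
    have hden : (1 - -1 * Real.sinh χ ^ 2) = Real.cosh χ ^ 2 := by rw [hc]; ring
    rw [hden]
    field_simp
    have hs : Real.sinh χ ^ 2 = Real.cosh χ ^ 2 - 1 := by rw [hc]; ring
    ring_nf
    simp only [hs]
    ring

/-- The Robertson-Walker metric `-dt² + a(t)² (dχ² + S_k(χ)² dΩ²)` at the event `p`. -/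
def metric {d : ℕ} (a : ℝ → ℝ) (k : ℝ) (p u v : Event d) : ℝ :=
  -(u.1 * v.1) + a p.1 ^ 2 * spatialMetric k p.2 u.2 v.2

/-- The Christoffel symbols of the first kind, `Γ(u, v, w) = g(∇_u v, w)` for constant
coordinate vector fields. -/
def christoffel {d : ℕ} (a : ℝ → ℝ) (k : ℝ) (p u v w : Event d) : ℝ :=
  (1 / 2) * (fderiv ℝ (fun q => metric a k q v w) p u
    + fderiv ℝ (fun q => metric a k q u w) p v
    - fderiv ℝ (fun q => metric a k q u v) p w)

/-- The covariant derivative of the vector field `Y` along the curve `γ` at parameter `s`,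
paired with `w` by the metric. -/
def covDeriv {d : ℕ} (a : ℝ → ℝ) (k : ℝ) (γ Y : ℝ → Event d) (s : ℝ) (w : Event d) : ℝ :=
  metric a k (γ s) (deriv Y s) w + christoffel a k (γ s) (deriv γ s) (Y s) w

/-- `γ` is an affinely parametrized geodesic of the spacetime on the open parameter set `J`. -/
structure IsGeodesicOn {d : ℕ} (a : ℝ → ℝ) (k : ℝ) (γ : ℝ → Event d) (J : Set ℝ) : Prop where
  isOpen : IsOpen J
  time_pos : ∀ s ∈ J, 0 < (γ s).1
  differentiableAt : ∀ s ∈ J, DifferentiableAt ℝ γ s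
  differentiableAt_deriv : ∀ s ∈ J, DifferentiableAt ℝ (deriv γ) s
  equation : ∀ s ∈ J, ∀ w : Event d, covDeriv a k γ (deriv γ) s w = 0

/-- `exp_p v` is defined and equal to `q`. -/
def HasExp {d : ℕ} (a : ℝ → ℝ) (k : ℝ) (p v q : Event d) : Prop :=
  ∃ (γ : ℝ → Event d) (J : Set ℝ), IsGeodesicOn a k γ J ∧ Icc 0 1 ⊆ J ∧
    γ 0 = p ∧ deriv γ 0 = v ∧ γ 1 = q

/-- The world line of the central comoving observer, parametrized by proper time. -/
def observer {d : ℕ} (τ : ℝ) : Event d := (τ, 0)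

/-- An orthonormal frame of the orthogonal complement of the observer's 4-velocity, parallel
along the observer's world line; `e τ y` is the vector `∑ yⁱ eᵢ(τ)`. -/
structure IsFermiFrame {d : ℕ} (a : ℝ → ℝ) (k : ℝ) (e : ℝ → Space d →L[ℝ] Event d) : Prop where
  orthonormal : ∀ τ, 0 < τ → ∀ y z,
    metric a k (observer τ) (e τ y) (e τ z) = inner ℝ y z
  orthogonal : ∀ τ, 0 < τ → ∀ y,
    metric a k (observer τ) (e τ y) (deriv observer τ) = 0
  differentiableAt : ∀ τ, 0 < τ → ∀ y, DifferentiableAt ℝ (fun s => e s y) τ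
  parallel : ∀ τ, 0 < τ → ∀ y w, covDeriv a k observer (fun s => e s y) τ w = 0

/-- `c = (τ, y)` are Fermi coordinates of the event `q`, off the observer's world line:
`q = exp_{β(τ)} (∑ yⁱ eᵢ(τ))`. The radial Fermi coordinate is `ρ = |y|`, the proper length of
the spacelike geodesic from `β(τ)` to `q`. -/
def HasFermiCoords {d : ℕ} (a : ℝ → ℝ) (k : ℝ) (e : ℝ → Space d →L[ℝ] Event d)
    (q c : Event d) : Prop :=
  0 < c.1 ∧ c.2 ≠ 0 ∧ HasExp a k (observer c.1) (e c.1 c.2) q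

/-- A Fermi coordinate chart off the observer's world line: a diffeomorphism from an open set
of events onto an open set of coordinates, that sends each event to Fermi coordinates of it. -/
structure IsFermiChart {d : ℕ} (a : ℝ → ℝ) (k : ℝ) (e : ℝ → Space d →L[ℝ] Event d)
    (Φ : OpenPartialHomeomorph (Event d) (Event d)) : Prop where
  contDiffOn : ContDiffOn ℝ ∞ Φ Φ.source
  contDiffOn_symm : ContDiffOn ℝ ∞ Φ.symm Φ.target
  hasFermiCoords : ∀ q ∈ Φ.source, HasFermiCoords a k e q (Φ q)

/-- The `χ`-coordinate at time `t` of the cosmological event horizon. -/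
def chiHoriz (a : ℝ → ℝ) (t : ℝ) : ℝ := ∫ s in Ioi t, 1 / a s

/-- The set `𝒱` of curvature coordinates `(t, χ)` inside the event horizon. -/
def regionV (a : ℝ → ℝ) : Set (ℝ × ℝ) := {p | 0 < p.1 ∧ 0 < p.2 ∧ p.2 < chiHoriz a p.1}

/-- The proper radius of the Fermi space slice at proper time `τ` of the observer. -/
def sliceRadius (a : ℝ → ℝ) (τ : ℝ) : ℝ :=
  ∫ t in Ioo 0 τ, a t / √(a τ ^ 2 - a t ^ 2)

/-- The set `𝒰_Fermi` of Fermi coordinates `(τ, ρ)`. -/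
def regionU (a : ℝ → ℝ) : Set (ℝ × ℝ) := {c | 0 < c.1 ∧ 0 < c.2 ∧ c.2 < sliceRadius a c.1}

/-- The events whose curvature coordinates `(t, χ)` lie in `A`. -/
def eventsOver {d : ℕ} (k : ℝ) (A : Set (ℝ × ℝ)) : Set (Event d) :=
  {p | ∃ (χ : ℝ) (n : Space d), ‖n‖ = 1 ∧ p.2 = radial k χ • n ∧ (p.1, χ) ∈ A}

end

end RW

/-! Put `β = 1/α`. A geodesic leaving the observer orthogonally at proper time `τ` is radial, and
along it `a(t)² χ'` is conserved. With `a(t) = a(τ) cos θ`, that is `t = τ cos^β θ`, the unit-speed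
equations integrate to `ρ = τ β ∫₀^θ cos^β` (`arc`) and `χ = τ^(1-α) β ∫₀^θ cos^(β-2)`
(`radialArc`). The time coordinate reaches `0` exactly at `θ = π/2`, at the finite length `τ β arc β
(π/2)`, which is the slice radius; so `(τ, θ)` with `0 < θ < π/2` parametrizes the Fermi range in
each direction.

The power law makes the geometry self-similar: since `χ_horiz(t) = t^(1-α)/(α-1)`, the quotient
`χ/χ_horiz(t)` does not involve `τ` (`chi_mul_rpow`). It equals `horizonRatio β θ = sin θ - β
cos^(1-β) θ · arc β θ`, which increases strictly from `0` to `1` on `(0, π/2)`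
(`bijOn_horizonRatio`). Hence an event inside the horizon determines `θ` from this quotient and then
`τ = t cos^(-β) θ`, both smoothly, and no other event is reached.

Maximality comes from uniqueness of geodesics (`IsGeodesicOn.eqOn`). Every geodesic with the
prescribed initial data agrees with the explicit one, and none can be continued to the parameter
where `t` would vanish (`hasFermiCoords_iff`). A parallel frame is a fixed isometry divided by
`a(τ)`, so its choice only rotates or reflects `y`. -/

namespace RW

open Filter Topology Real

noncomputable section

/-! ### Uniqueness of integral curves and smoothness of inverse functions -/

/-- Two integral curves of a time-independent vector field that is `C¹` along one of them agree on
a connected parameter set as soon as they agree at one parameter. -/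
theorem eqOn_of_hasDerivAt_of_contDiffAt {E : Type*} [NormedAddCommGroup E] [NormedSpace ℝ E]
    {v : E → E} {f g : ℝ → E} {U S : Set ℝ} (hU : IsOpen U) (hS : IsPreconnected S) (hSU : S ⊆ U)
    (hv : ∀ t ∈ U, ContDiffAt ℝ 1 v (f t))
    (hf : ∀ t ∈ U, HasDerivAt f (v (f t)) t) (hg : ∀ t ∈ U, HasDerivAt g (v (g t)) t)
    {t₀ : ℝ} (ht₀ : t₀ ∈ S) (heq : f t₀ = g t₀) : EqOn f g S := by
  -- The agreement set is open by local Lipschitz uniqueness and relatively closed by continuity, so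
  -- connectedness of `S` concludes.
  set u : Set ℝ := {t | t ∈ U ∧ f t = g t} with hu
  have hopen : IsOpen u := by
    rw [isOpen_iff_mem_nhds]
    rintro t ⟨htU, hfg⟩
    obtain ⟨K, s, hs, hK⟩ := (hv t htU).exists_lipschitzOnWith
    have hUt := hU.mem_nhds htU
    have h1 : ∀ᶠ r in 𝓝 t, HasDerivAt f (v (f r)) r ∧ f r ∈ s := by
      filter_upwards [hUt, (hf t htU).continuousAt hs] with r hr hr' using ⟨hf r hr, hr'⟩
    have h2 : ∀ᶠ r in 𝓝 t, HasDerivAt g (v (g r)) r ∧ g r ∈ s := by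
      have hs' : s ∈ 𝓝 (g t) := hfg ▸ hs
      filter_upwards [hUt, (hg t htU).continuousAt hs'] with r hr hr' using ⟨hg r hr, hr'⟩
    have h3 : f =ᶠ[𝓝 t] g :=
      ODE_solution_unique_of_eventually (v := fun _ => v) (s := fun _ => s)
        (Eventually.of_forall fun _ => hK) h1 h2 hfg
    filter_upwards [hUt, h3] with r hr hr' using ⟨hr, hr'⟩
  have hsub : S ⊆ u := by
    refine hS.subset_of_closure_inter_subset hopen ⟨t₀, ht₀, hSU ht₀, heq⟩ ?_
    rintro t ⟨htc, htS⟩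
    refine ⟨hSU htS, ?_⟩
    have hne : (𝓝[u] t).NeBot := mem_closure_iff_nhdsWithin_neBot.mp htc
    have h1 : Tendsto f (𝓝[u] t) (𝓝 (f t)) :=
      (hf t (hSU htS)).continuousAt.tendsto.mono_left nhdsWithin_le_nhds
    have h2 : Tendsto g (𝓝[u] t) (𝓝 (g t)) :=
      (hg t (hSU htS)).continuousAt.tendsto.mono_left nhdsWithin_le_nhds
    refine tendsto_nhds_unique (h1.congr' ?_) h2
    filter_upwards [self_mem_nhdsWithin] with r hr using hr.2
  exact fun t ht => (hsub ht).2

/-- A smooth bijection between open sets of reals with nonvanishing derivative has a smooth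
inverse. -/
theorem contDiffOn_invFunOn {f f' : ℝ → ℝ} {s t : Set ℝ} (hs : IsOpen s)
    (hbij : BijOn f s t) (hf : ContDiffOn ℝ ∞ f s) (hd : ∀ x ∈ s, HasDerivAt f (f' x) x)
    (hne : ∀ x ∈ s, f' x ≠ 0) :
    ContDiffOn ℝ ∞ (Function.invFunOn f s) t ∧
      ∀ y ∈ t, HasDerivAt (Function.invFunOn f s) (f' (Function.invFunOn f s y))⁻¹ y := by
  have key := hbij.invOn_invFunOn
  set g := Function.invFunOn f s
  have hmaps : MapsTo g t s := by
    intro y hy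
    obtain ⟨x, hx, rfl⟩ := hbij.surjOn hy
    rw [key.1 hx]; exact hx
  have hloc : ∀ y ∈ t, ContDiffAt ℝ ∞ g y := by
    intro y hy
    obtain ⟨x, hx, rfl⟩ := hbij.surjOn hy
    have hfx : ContDiffAt ℝ ∞ f x := hf.contDiffAt (hs.mem_nhds hx)
    have hdx := hd x hx
    have hdx' := hdx.hasFDerivAt_equiv (hne x hx)
    have hn : (∞ : WithTop ℕ∞) ≠ 0 := by simp
    have hL := hfx.to_localInverse hdx' hn
    refine hL.congr_of_eventuallyEq ?_
    have h0 := hfx.localInverse_apply_image hdx' hn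
    -- The local inverse of the inverse function theorem takes values in `s` near `f x`; injectivity
    -- of `f` on `s` then identifies it with `g`.
    have h1 : ∀ᶠ z in 𝓝 (f x), hfx.localInverse hdx' hn z ∈ s := by
      apply hL.continuousAt
      rw [h0]; exact hs.mem_nhds hx
    have h2 : ∀ᶠ z in 𝓝 (f x), f (hfx.localInverse hdx' hn z) = z :=
      HasStrictFDerivAt.eventually_right_inverse _
    filter_upwards [h1, h2] with z hz hz'
    have := key.1 hz
    rw [hz'] at this
    exact this
  refine ⟨fun y hy => (hloc y hy).contDiffWithinAt, fun y hy => ?_⟩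
  have ht : t ∈ 𝓝 y := by
    have h1 : ∀ᶠ z in 𝓝 y, g z ∈ s := (hloc y hy).continuousAt (hs.mem_nhds (hmaps hy))
    obtain ⟨x, hx, rfl⟩ := hbij.surjOn hy
    have := (hf.contDiffAt (hs.mem_nhds hx)).hasStrictDerivAt' (hd x hx) (by simp)
    have hmap := this.map_nhds_eq (hne x hx)
    rw [← hmap]
    exact mem_map.mpr (mem_of_superset (hs.mem_nhds hx) hbij.mapsTo)
  refine HasDerivAt.of_local_left_inverse (hloc y hy).continuousAt (hd _ (hmaps hy))
    (hne _ (hmaps hy)) ?_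
  filter_upwards [ht] with z hz using key.2 hz

/-- A continuous function on `[a, b]` with positive derivative inside is a bijection of open
intervals. -/
theorem bijOn_Ioo_of_hasDerivAt_pos {f f' : ℝ → ℝ} {a b : ℝ} (hab : a < b)
    (hc : ContinuousOn f (Icc a b)) (hd : ∀ x ∈ Ioo a b, HasDerivAt f (f' x) x)
    (hpos : ∀ x ∈ Ioo a b, 0 < f' x) : BijOn f (Ioo a b) (Ioo (f a) (f b)) := by
  have hmono : StrictMonoOn f (Icc a b) := by
    refine strictMonoOn_of_deriv_pos (convex_Icc a b) hc fun x hx => ?_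
    rw [interior_Icc] at hx
    rw [(hd x hx).deriv]; exact hpos x hx
  refine ⟨fun x hx => ?_, hmono.injOn.mono Ioo_subset_Icc_self, ?_⟩
  · exact ⟨hmono (left_mem_Icc.2 hab.le) (Ioo_subset_Icc_self hx) hx.1,
      hmono (Ioo_subset_Icc_self hx) (right_mem_Icc.2 hab.le) hx.2⟩
  · exact intermediate_value_Ioo hab.le hc

/-! ### Length, radial coordinate and horizon ratio as functions of the angle -/

/-- Along a spacelike geodesic orthogonal to the observer write `t = τ cos^β θ`, where `a = t^(1/β)`.
The proper length is then `τ β` times this integral. -/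
def arc (β θ : ℝ) : ℝ := ∫ x in (0 : ℝ)..θ, cos x ^ β

/-- The antiderivative of `cos^(β - 2)` that vanishes at `0`. -/
def radialArc (β θ : ℝ) : ℝ := (sin θ * cos θ ^ (β - 1) - β * arc β θ) / (1 - β)

/-- The ratio of the `χ`-coordinate of the event with parameter `θ` to that of the horizon. -/
def horizonRatio (β θ : ℝ) : ℝ := sin θ - β * cos θ ^ (1 - β) * arc β θ

theorem arc_zero (β : ℝ) : arc β 0 = 0 := by simp [arc]

theorem hasDerivAt_arc {β : ℝ} (hβ : 0 ≤ β) (θ : ℝ) : HasDerivAt (arc β) (cos θ ^ β) θ := by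
  have hc : Continuous fun x : ℝ => cos x ^ β :=
    continuous_cos.rpow_const fun _ => Or.inr hβ
  exact (hc.integral_hasStrictDerivAt 0 θ).hasDerivAt

theorem arc_neg (β θ : ℝ) : arc β (-θ) = -arc β θ := by
  have := intervalIntegral.integral_comp_neg (a := 0) (b := θ) fun x : ℝ => cos x ^ β
  simp only [cos_neg, neg_zero] at this
  rw [arc, arc, this, intervalIntegral.integral_symm]

/-- The symmetric interval is needed because a geodesic must be defined on an open parameter set
around the observer's event `θ = 0`. -/
theorem bijOn_arc {β : ℝ} (hβ : 0 ≤ β) :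
    BijOn (arc β) (Ioo (-(π / 2)) (π / 2)) (Ioo (-arc β (π / 2)) (arc β (π / 2))) := by
  have h := bijOn_Ioo_of_hasDerivAt_pos (f := arc β) (f' := fun θ => cos θ ^ β)
    (a := -(π / 2)) (b := π / 2) (by linarith [pi_pos])
    (fun θ _ => (hasDerivAt_arc hβ θ).continuousAt.continuousWithinAt)
    (fun θ _ => hasDerivAt_arc hβ θ) fun θ hθ => rpow_pos_of_pos (cos_pos_of_mem_Ioo hθ) _
  rwa [arc_neg] at h

theorem bijOn_arc_pos {β : ℝ} (hβ : 0 ≤ β) :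
    BijOn (arc β) (Ioo 0 (π / 2)) (Ioo 0 (arc β (π / 2))) := by
  have h := bijOn_Ioo_of_hasDerivAt_pos (f := arc β) (f' := fun θ => cos θ ^ β)
    (a := 0) (b := π / 2) (by linarith [pi_pos])
    (fun θ _ => (hasDerivAt_arc hβ θ).continuousAt.continuousWithinAt)
    (fun θ _ => hasDerivAt_arc hβ θ)
    fun θ hθ => rpow_pos_of_pos (cos_pos_of_mem_Ioo ⟨by linarith [hθ.1, pi_pos], hθ.2⟩) _
  rwa [arc_zero] at h

theorem arc_pi_div_two_pos {β : ℝ} (hβ : 0 ≤ β) : 0 < arc β (π / 2) := by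
  have h : π / 4 ∈ Ioo 0 (π / 2) := ⟨by linarith [pi_pos], by linarith [pi_pos]⟩
  have := (bijOn_arc_pos hβ).mapsTo h
  exact this.1.trans this.2

theorem contDiffAt_cos_rpow {β θ : ℝ} (hθ : θ ∈ Ioo (-(π / 2)) (π / 2)) :
    ContDiffAt ℝ ∞ (fun θ => cos θ ^ β) θ :=
  contDiff_cos.contDiffAt.rpow_const_of_ne (cos_pos_of_mem_Ioo hθ).ne'

theorem hasDerivAt_cos_rpow {β θ : ℝ} (hθ : θ ∈ Ioo (-(π / 2)) (π / 2)) :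
    HasDerivAt (fun θ => cos θ ^ β) (-(β * sin θ * cos θ ^ (β - 1))) θ := by
  convert (hasDerivAt_cos θ).rpow_const (p := β) (Or.inl (cos_pos_of_mem_Ioo hθ).ne') using 1
  ring

theorem contDiffOn_arc {β : ℝ} (hβ : 0 ≤ β) :
    ContDiffOn ℝ ∞ (arc β) (Ioo (-(π / 2)) (π / 2)) := by
  rw [contDiffOn_infty_iff_deriv_of_isOpen isOpen_Ioo]
  refine ⟨fun θ _ => (hasDerivAt_arc hβ θ).differentiableAt.differentiableWithinAt, ?_⟩
  have h : deriv (arc β) = fun θ => cos θ ^ β := funext fun θ => (hasDerivAt_arc hβ θ).deriv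
  rw [h]
  exact fun θ hθ => (contDiffAt_cos_rpow hθ).contDiffWithinAt

/-- This is the reduction formula `(sin · cos^(β-1))' = (1-β) cos^(β-2) + β cos^β`. It isolates the
part of the integral that is singular at `π/2`. -/
theorem hasDerivAt_radialArc {β θ : ℝ} (hβ : 0 ≤ β) (hβ1 : β < 1)
    (hθ : θ ∈ Ioo (-(π / 2)) (π / 2)) : HasDerivAt (radialArc β) (cos θ ^ (β - 2)) θ := by
  have hc := cos_pos_of_mem_Ioo hθ
  have h := (((hasDerivAt_sin θ).mul (hasDerivAt_cos_rpow (β := β - 1) hθ)).sub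
    ((hasDerivAt_arc hβ θ).const_mul β)).div_const (1 - β)
  refine h.congr_deriv ?_
  have e1 : cos θ ^ (β - 1) = cos θ * cos θ ^ (β - 2) := by
    rw [← rpow_one_add' hc.le (by linarith)]; ring_nf
  have e2 : cos θ ^ β = cos θ ^ 2 * cos θ ^ (β - 2) := by
    rw [← rpow_natCast, ← rpow_add hc]; norm_num
  have e3 : β - 1 - 1 = β - 2 := by ring
  rw [e3, e1, e2]
  have : 1 - β ≠ 0 := by linarith
  field_simp
  linear_combination (1 - β) * (sin_sq_add_cos_sq θ)

theorem contDiffOn_radialArc {β : ℝ} (hβ : 0 ≤ β) :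
    ContDiffOn ℝ ∞ (radialArc β) (Ioo (-(π / 2)) (π / 2)) :=
  ((contDiff_sin.contDiffOn.mul fun _ hθ => (contDiffAt_cos_rpow hθ).contDiffWithinAt).sub
    (contDiffOn_const.mul (contDiffOn_arc hβ))).div_const _

theorem radialArc_zero (β : ℝ) : radialArc β 0 = 0 := by simp [radialArc, arc_zero]

/-- The factor `cos^(1-β)` cancels the blow-up of `radialArc`, which is why `horizonRatio` is
defined by a formula that stays continuous at `π/2`. -/
theorem horizonRatio_eq {β θ : ℝ} (hβ1 : β < 1) (hθ : θ ∈ Ioo (-(π / 2)) (π / 2)) :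
    horizonRatio β θ = (1 - β) * cos θ ^ (1 - β) * radialArc β θ := by
  have hc := cos_pos_of_mem_Ioo hθ
  have : 1 - β ≠ 0 := by linarith
  have h : cos θ ^ (1 - β) * cos θ ^ (β - 1) = 1 := by
    rw [← rpow_add hc]; simp
  rw [horizonRatio, radialArc]
  field_simp
  linear_combination -sin θ * h

theorem hasDerivAt_horizonRatio {β θ : ℝ} (hβ : 0 ≤ β) (hθ : θ ∈ Ioo (-(π / 2)) (π / 2)) :
    HasDerivAt (horizonRatio β) ((1 - β) * (cos θ + β * sin θ * cos θ ^ (-β) * arc β θ)) θ := by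
  have hc := cos_pos_of_mem_Ioo hθ
  have h := (hasDerivAt_sin θ).sub
    (((hasDerivAt_cos_rpow (β := 1 - β) hθ).const_mul β).mul (hasDerivAt_arc hβ θ))
  refine h.congr_deriv ?_
  have e : cos θ ^ (1 - β) * cos θ ^ β = cos θ := by rw [← rpow_add hc]; simp
  have e3 : 1 - β - 1 = -β := by ring
  rw [e3]
  linear_combination -β * e

theorem contDiffOn_horizonRatio {β : ℝ} (hβ : 0 ≤ β) :
    ContDiffOn ℝ ∞ (horizonRatio β) (Ioo (-(π / 2)) (π / 2)) :=
  contDiff_sin.contDiffOn.sub ((contDiffOn_const.mul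
    fun _ hθ => (contDiffAt_cos_rpow hθ).contDiffWithinAt).mul (contDiffOn_arc hβ))

theorem Ioo_zero_subset : Ioo 0 (π / 2) ⊆ Ioo (-(π / 2)) (π / 2) :=
  Ioo_subset_Ioo_left (by linarith [pi_pos])

theorem deriv_horizonRatio_pos {β θ : ℝ} (hβ : 0 ≤ β) (hβ1 : β < 1) (hθ : θ ∈ Ioo 0 (π / 2)) :
    0 < (1 - β) * (cos θ + β * sin θ * cos θ ^ (-β) * arc β θ) := by
  have hc := cos_pos_of_mem_Ioo (Ioo_zero_subset hθ)
  have hs := sin_pos_of_pos_of_lt_pi hθ.1 (by linarith [hθ.2, pi_pos])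
  have ha := ((bijOn_arc_pos hβ).mapsTo hθ).1
  have := sub_pos.2 hβ1
  positivity

/-- At `π/2` the term with `cos^(1-β)` vanishes because `β < 1`, leaving `sin (π/2) = 1`: the
geodesics approach the horizon as `θ → π/2`. Monotonicity holds since both terms of the derivative
are positive. -/
theorem bijOn_horizonRatio {β : ℝ} (hβ : 0 ≤ β) (hβ1 : β < 1) :
    BijOn (horizonRatio β) (Ioo 0 (π / 2)) (Ioo 0 1) := by
  have hcont : Continuous (horizonRatio β) := by
    have h1 : Continuous (arc β) :=
      continuous_iff_continuousAt.2 fun θ => (hasDerivAt_arc hβ θ).continuousAt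
    have h2 : Continuous fun x : ℝ => cos x ^ (1 - β) :=
      continuous_cos.rpow_const fun _ => Or.inr (by linarith)
    exact continuous_sin.sub ((continuous_const.mul h2).mul h1)
  have h := bijOn_Ioo_of_hasDerivAt_pos (by linarith [pi_pos] : (0 : ℝ) < π / 2) hcont.continuousOn
    (fun θ hθ => hasDerivAt_horizonRatio hβ (Ioo_zero_subset hθ))
    fun θ hθ => deriv_horizonRatio_pos hβ hβ1 hθ
  have h0 : horizonRatio β 0 = 0 := by simp [horizonRatio, arc_zero]
  have h1 : horizonRatio β (π / 2) = 1 := by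
    simp [horizonRatio, zero_rpow (by linarith : 1 - β ≠ 0)]
  rwa [h0, h1] at h

/-- The inverse function of `arc` on `(-π/2, π/2)`. -/
def arcInv (β : ℝ) : ℝ → ℝ := Function.invFunOn (arc β) (Ioo (-(π / 2)) (π / 2))

/-- The inverse function of `horizonRatio` on `(0, π/2)`. -/
def ratioInv (β : ℝ) : ℝ → ℝ := Function.invFunOn (horizonRatio β) (Ioo 0 (π / 2))

theorem arcInv_arc {β θ : ℝ} (hβ : 0 ≤ β) (hθ : θ ∈ Ioo (-(π / 2)) (π / 2)) :
    arcInv β (arc β θ) = θ :=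
  (bijOn_arc hβ).invOn_invFunOn.1 hθ

theorem arcInv_mem {β r : ℝ} (hβ : 0 ≤ β) (hr : r ∈ Ioo (-arc β (π / 2)) (arc β (π / 2))) :
    arcInv β r ∈ Ioo (-(π / 2)) (π / 2) := by
  obtain ⟨θ, hθ, rfl⟩ := (bijOn_arc hβ).surjOn hr
  rwa [arcInv_arc hβ hθ]

theorem ratioInv_horizonRatio {β θ : ℝ} (hβ : 0 ≤ β) (hβ1 : β < 1) (hθ : θ ∈ Ioo 0 (π / 2)) :
    ratioInv β (horizonRatio β θ) = θ :=
  (bijOn_horizonRatio hβ hβ1).invOn_invFunOn.1 hθ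

theorem contDiffOn_arcInv {β : ℝ} (hβ : 0 ≤ β) :
    ContDiffOn ℝ ∞ (arcInv β) (Ioo (-arc β (π / 2)) (arc β (π / 2))) :=
  (contDiffOn_invFunOn isOpen_Ioo (bijOn_arc hβ) (contDiffOn_arc hβ)
    (fun θ _ => hasDerivAt_arc hβ θ)
    fun _ hθ => (rpow_pos_of_pos (cos_pos_of_mem_Ioo hθ) _).ne').1

theorem hasDerivAt_arcInv {β r : ℝ} (hβ : 0 ≤ β)
    (hr : r ∈ Ioo (-arc β (π / 2)) (arc β (π / 2))) :
    HasDerivAt (arcInv β) (cos (arcInv β r) ^ β)⁻¹ r :=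
  (contDiffOn_invFunOn isOpen_Ioo (bijOn_arc hβ) (contDiffOn_arc hβ)
    (fun θ _ => hasDerivAt_arc hβ θ)
    fun _ hθ => (rpow_pos_of_pos (cos_pos_of_mem_Ioo hθ) _).ne').2 r hr

theorem contDiffOn_ratioInv {β : ℝ} (hβ : 0 ≤ β) (hβ1 : β < 1) :
    ContDiffOn ℝ ∞ (ratioInv β) (Ioo 0 1) :=
  (contDiffOn_invFunOn isOpen_Ioo
    (bijOn_horizonRatio hβ hβ1) ((contDiffOn_horizonRatio hβ).mono Ioo_zero_subset)
    (fun _ hθ => hasDerivAt_horizonRatio hβ (Ioo_zero_subset hθ))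
    fun _ hθ => (deriv_horizonRatio_pos hβ hβ1 hθ).ne').1

/-! ### Horizon and slice radius for the power law -/

theorem chiHoriz_of_eq_rpow {α : ℝ} (hα : 1 < α) {a : ℝ → ℝ} (ha : ∀ t, 0 < t → a t = t ^ α)
    {t : ℝ} (ht : 0 < t) : chiHoriz a t = t ^ (1 - α) / (α - 1) := by
  have h : chiHoriz a t = ∫ s in Ioi t, s ^ (-α) := by
    refine setIntegral_congr_fun measurableSet_Ioi fun s hs => ?_
    have hs' : 0 < s := ht.trans hs
    simp only [ha s hs', rpow_neg hs'.le, one_div]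
  rw [h, integral_Ioi_rpow_of_lt (by linarith) ht]
  rw [show -α + 1 = -(α - 1) by ring, neg_div_neg_eq]
  ring_nf

/-- The substitution `t = τ cos^β θ` turns the square root into `a(τ) sin θ`, which cancels the sine
in `dt` and removes the endpoint singularity. -/
theorem sliceRadius_of_eq_rpow {α : ℝ} (hα : 1 < α) {a : ℝ → ℝ} (ha : ∀ t, 0 < t → a t = t ^ α)
    {τ : ℝ} (hτ : 0 < τ) : sliceRadius a τ = τ * α⁻¹ * arc α⁻¹ (π / 2) := by
  have hα0 : 0 < α := by linarith
  set β := α⁻¹ with hβdef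
  have hβ : 0 < β := inv_pos.2 hα0
  set f : ℝ → ℝ := fun θ => τ * cos θ ^ β with hf
  set f' : ℝ → ℝ := fun θ => τ * -(β * sin θ * cos θ ^ (β - 1)) with hf'
  have hd : ∀ θ ∈ Ioo 0 (π / 2), HasDerivAt f (f' θ) θ := fun θ hθ =>
    (hasDerivAt_cos_rpow (Ioo_zero_subset hθ)).const_mul τ
  have hsin : ∀ θ ∈ Ioo 0 (π / 2), 0 < sin θ := fun θ hθ =>
    sin_pos_of_pos_of_lt_pi hθ.1 (by linarith [hθ.2, pi_pos])
  have hcos : ∀ θ ∈ Ioo 0 (π / 2), 0 < cos θ := fun θ hθ =>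
    cos_pos_of_mem_Ioo (Ioo_zero_subset hθ)
  have hneg : ∀ θ ∈ Ioo 0 (π / 2), 0 < -f' θ := fun θ hθ => by
    have := hsin θ hθ
    have := rpow_pos_of_pos (hcos θ hθ) (β - 1)
    simp only [hf', mul_neg, neg_neg]
    positivity
  have hfc : Continuous f :=
    continuous_const.mul (continuous_cos.rpow_const fun _ => Or.inr hβ.le)
  -- The substitution is decreasing, so the increasing bijection lemma is applied to `-f`.
  have hbij := bijOn_Ioo_of_hasDerivAt_pos (f := fun θ => -f θ) (f' := fun θ => -f' θ)
    (by linarith [pi_pos] : (0 : ℝ) < π / 2) hfc.neg.continuousOn (fun θ hθ => (hd θ hθ).neg) hneg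
  have h0 : f 0 = τ := by simp [hf]
  have h1 : f (π / 2) = 0 := by simp [hf, zero_rpow hβ.ne']
  simp only [h0, h1] at hbij
  have hinj : InjOn f (Ioo 0 (π / 2)) := fun x hx y hy h =>
    hbij.injOn hx hy (by simp only [h])
  have himg : f '' Ioo 0 (π / 2) = Ioo 0 τ := by
    have h2 : f '' Ioo 0 (π / 2) = Neg.neg '' ((fun θ => -f θ) '' Ioo 0 (π / 2)) := by
      rw [image_image]; simp
    rw [h2, hbij.image_eq]; simp
  rw [sliceRadius, ← himg, integral_image_eq_integral_abs_deriv_smul measurableSet_Ioo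
    (fun θ hθ => (hd θ hθ).hasDerivWithinAt) hinj]
  rw [arc, intervalIntegral.integral_of_le (by linarith [pi_pos]), integral_Ioc_eq_integral_Ioo,
    ← integral_const_mul]
  refine setIntegral_congr_fun measurableSet_Ioo fun θ hθ => ?_
  have hs := hsin θ hθ
  have hc := hcos θ hθ
  have hT := rpow_pos_of_pos hτ α
  have hfp : 0 < f θ := by have := rpow_pos_of_pos hc β; simp only [hf]; positivity
  have haf : a (f θ) = τ ^ α * cos θ := by
    rw [ha _ hfp]
    simp only [hf]
    rw [mul_rpow hτ.le (rpow_nonneg hc.le _), ← rpow_mul hc.le, hβdef, inv_mul_cancel₀ hα0.ne',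
      rpow_one]
  have hsq : √(a τ ^ 2 - a (f θ) ^ 2) = τ ^ α * sin θ := by
    rw [haf, ha τ hτ]
    have : (τ ^ α) ^ 2 - (τ ^ α * cos θ) ^ 2 = (τ ^ α * sin θ) ^ 2 := by
      linear_combination -(τ ^ α) ^ 2 * sin_sq_add_cos_sq θ
    rw [this, sqrt_sq (by positivity)]
  have hab : |f' θ| = -f' θ := abs_of_neg (by linarith [hneg θ hθ])
  rw [hsq, haf, hab, smul_eq_mul]
  simp only [hf']
  have e1 : cos θ ^ β = cos θ * cos θ ^ (β - 1) := by
    rw [← rpow_one_add' hc.le (by linarith)]; ring_nf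
  rw [e1]
  field_simp

/-! ### The Levi-Civita connection -/

theorem hasDerivAt_inner_line {d : ℕ} (x u v : Space d) :
    HasDerivAt (fun s : ℝ => (inner ℝ (x + s • u) v : ℝ)) (inner ℝ u v) 0 := by
  have h : (fun s : ℝ => (inner ℝ (x + s • u) v : ℝ)) = fun s => inner ℝ x v + s * inner ℝ u v := by
    funext s; rw [inner_add_left, real_inner_smul_left]
  rw [h]
  simpa using ((hasDerivAt_id (0 : ℝ)).mul_const (inner ℝ u v : ℝ)).const_add (inner ℝ x v : ℝ)

theorem differentiableAt_metric {d : ℕ} {a : ℝ → ℝ} {k a' : ℝ} {p : Event d}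
    (ha : HasDerivAt a a' p.1) (hD : 1 - k * ‖p.2‖ ^ 2 ≠ 0) (v w : Event d) :
    DifferentiableAt ℝ (fun q => metric a k q v w) p := by
  have h1 : DifferentiableAt ℝ (fun q : Event d => a q.1) p :=
    ha.differentiableAt.comp p differentiableAt_fst
  have h2 : DifferentiableAt ℝ (fun q : Event d => ‖q.2‖ ^ 2) p :=
    differentiableAt_snd.norm_sq ℝ
  have h3 (z : Space d) : DifferentiableAt ℝ (fun q : Event d => (inner ℝ q.2 z : ℝ)) p :=
    differentiableAt_snd.inner ℝ (differentiableAt_const z)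
  have h4 : DifferentiableAt ℝ (fun q : Event d => 1 - k * ‖q.2‖ ^ 2) p :=
    (h2.const_mul k).const_sub 1
  have h5 : DifferentiableAt ℝ (fun q : Event d =>
      k * (inner ℝ q.2 v.2 * inner ℝ q.2 w.2) / (1 - k * ‖q.2‖ ^ 2)) p := by
    have h6 := ((h3 v.2).fun_mul (h3 w.2)).const_mul k
    simp only [div_eq_mul_inv]
    exact h6.fun_mul (h4.fun_inv hD)
  unfold metric spatialMetric
  exact (differentiableAt_const _).add ((h1.pow 2).mul ((differentiableAt_const _).add h5))

theorem fderiv_metric {d : ℕ} {a : ℝ → ℝ} {k a' : ℝ} {p : Event d}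
    (ha : HasDerivAt a a' p.1) (hD : 1 - k * ‖p.2‖ ^ 2 ≠ 0) (u v w : Event d) :
    fderiv ℝ (fun q => metric a k q v w) p u =
      2 * a p.1 * a' * u.1 * spatialMetric k p.2 v.2 w.2 + a p.1 ^ 2 *
        (k * (inner ℝ u.2 v.2 * inner ℝ p.2 w.2 + inner ℝ p.2 v.2 * inner ℝ u.2 w.2) /
            (1 - k * ‖p.2‖ ^ 2) +
          2 * k ^ 2 * inner ℝ p.2 v.2 * inner ℝ p.2 w.2 * inner ℝ p.2 u.2 /
            (1 - k * ‖p.2‖ ^ 2) ^ 2) := by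
  -- Differentiability being known, the derivative can be computed along the line `p + s u` by
  -- one-variable calculus.
  have hline := (differentiableAt_metric ha hD v w).hasFDerivAt.hasLineDerivAt u
  refine HasDerivAt.unique hline ?_
  have hat : HasDerivAt (fun s : ℝ => a (p.1 + s * u.1)) (a' * u.1) 0 := by
    have h0 : HasDerivAt (fun s : ℝ => p.1 + s * u.1) u.1 0 := by
      simpa using ((hasDerivAt_id (0 : ℝ)).mul_const u.1).const_add p.1
    have ha0 : HasDerivAt a a' (p.1 + 0 * u.1) := by simpa using ha
    exact HasDerivAt.comp (0 : ℝ) ha0 h0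
  have hn : HasDerivAt (fun s : ℝ => ‖p.2 + s • u.2‖ ^ 2) (2 * inner ℝ p.2 u.2) 0 := by
    have h0 : HasDerivAt (fun s : ℝ => p.2 + s • u.2) u.2 0 := by
      simpa using ((hasDerivAt_id (0 : ℝ)).smul_const u.2).const_add p.2
    simpa using h0.norm_sq
  have hv := hasDerivAt_inner_line p.2 u.2 v.2
  have hw := hasDerivAt_inner_line p.2 u.2 w.2
  have hD0 : 1 - k * ‖p.2 + (0 : ℝ) • u.2‖ ^ 2 ≠ 0 := by simpa using hD
  have h := ((hat.pow 2).mul ((((hv.mul hw).const_mul k).div ((hn.const_mul k).const_sub 1)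
    hD0).const_add (inner ℝ v.2 w.2))).const_add (-(v.1 * w.1))
  refine (h.congr_deriv ?_).congr_of_eventuallyEq (Eventually.of_forall fun s => ?_)
  · simp only [zero_smul, add_zero, zero_mul, Pi.pow_apply, Pi.mul_apply, Pi.div_apply,
      spatialMetric]
    field_simp
    ring
  · simp [metric, spatialMetric]

/-- The components `Γ(u, v)` of the Levi-Civita connection for the scale factor `t ^ α`. -/
def connection {d : ℕ} (α k : ℝ) (p u v : Event d) : Event d :=
  (α * p.1 ^ (2 * α - 1) * spatialMetric k p.2 u.2 v.2,
    (α / p.1) • (u.1 • v.2 + v.1 • u.2) + (k * spatialMetric k p.2 u.2 v.2) • p.2)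

theorem hasDerivAt_of_eq_rpow {α : ℝ} {a : ℝ → ℝ} (ha : ∀ t, 0 < t → a t = t ^ α) {t : ℝ}
    (ht : 0 < t) : HasDerivAt a (α * t ^ (α - 1)) t := by
  refine (hasDerivAt_rpow_const (p := α) (Or.inl ht.ne')).congr_of_eventuallyEq ?_
  filter_upwards [lt_mem_nhds ht] with s hs using ha s hs

/-- This raises the index of the Christoffel symbols, so that the weak equations tested against `w`
become vector equations. -/
theorem christoffel_eq_metric_connection {d : ℕ} {α k : ℝ} {a : ℝ → ℝ}
    (ha : ∀ t, 0 < t → a t = t ^ α) {p : Event d} (hp : 0 < p.1)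
    (hD : 1 - k * ‖p.2‖ ^ 2 ≠ 0) (u v w : Event d) :
    christoffel a k p u v w = metric a k p (connection α k p u v) w := by
  have ha' := hasDerivAt_of_eq_rpow ha hp
  rw [christoffel, fderiv_metric ha' hD, fderiv_metric ha' hD, fderiv_metric ha' hD, metric,
    connection, ha _ hp]
  have e1 : p.1 ^ (2 * α - 1) = p.1 ^ α * p.1 ^ (α - 1) := by
    rw [← rpow_add hp]; ring_nf
  have e2 : p.1 ^ α = p.1 * p.1 ^ (α - 1) := by
    rw [rpow_sub_one hp.ne']; field_simp
  rw [e1, e2]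
  simp only [spatialMetric, inner_add_left, inner_add_right, real_inner_smul_left,
    real_inner_smul_right, real_inner_self_eq_norm_sq, real_inner_comm u.2 v.2,
    real_inner_comm u.2 w.2, real_inner_comm v.2 w.2, real_inner_comm p.2]
  generalize (inner ℝ u.2 v.2 : ℝ) = uv
  field_simp
  ring

theorem metric_add_left {d : ℕ} (a : ℝ → ℝ) (k : ℝ) (p u v w : Event d) :
    metric a k p (u + v) w = metric a k p u w + metric a k p v w := by
  simp only [metric, spatialMetric, Prod.fst_add, Prod.snd_add, inner_add_left, inner_add_right]
  ring

theorem eq_zero_of_metric_eq_zero {d : ℕ} {a : ℝ → ℝ} {k : ℝ} {p u : Event d} (hp : a p.1 ≠ 0)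
    (hD : 1 - k * ‖p.2‖ ^ 2 ≠ 0) (h : ∀ w, metric a k p u w = 0) : u = 0 := by
  have h1 : u.1 = 0 := by simpa [metric, spatialMetric] using h (1, 0)
  have h2 : ∀ z : Space d, spatialMetric k p.2 u.2 z = 0 := fun z => by
    simpa [metric, hp] using h (0, z)
  -- Testing with `z = x` gives `⟨x, u⟩ / (1 - k|x|²) = 0`; the curvature term then drops out and
  -- the metric reduces to the Euclidean product.
  have h3 : (inner ℝ p.2 u.2 : ℝ) = 0 := by
    have := h2 p.2
    rw [spatialMetric, real_inner_self_eq_norm_sq, real_inner_comm] at this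
    field_simp at this
    linear_combination this
  have h4 := h2 u.2
  rw [spatialMetric, h3] at h4
  have h5 : u.2 = 0 := by simpa using h4
  exact Prod.ext h1 h5

theorem covDeriv_eq_zero_iff {d : ℕ} {α k : ℝ} {a : ℝ → ℝ}
    (ha : ∀ t, 0 < t → a t = t ^ α) {γ Y : ℝ → Event d} {s : ℝ} (hp : 0 < (γ s).1)
    (hD : 1 - k * ‖(γ s).2‖ ^ 2 ≠ 0) :
    (∀ w, covDeriv a k γ Y s w = 0) ↔ deriv Y s = -connection α k (γ s) (deriv γ s) (Y s) := by
  have h : ∀ w, covDeriv a k γ Y s w =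
      metric a k (γ s) (deriv Y s + connection α k (γ s) (deriv γ s) (Y s)) w := fun w => by
    rw [covDeriv, christoffel_eq_metric_connection ha hp hD, metric_add_left]
  simp only [h]
  refine ⟨fun h0 => eq_neg_of_add_eq_zero_left (eq_zero_of_metric_eq_zero ?_ hD h0), fun h0 w => ?_⟩
  · rw [ha _ hp]; exact (rpow_pos_of_pos hp _).ne'
  · rw [h0]; simp [metric, spatialMetric]

/-- For `k ≤ 0` the quasi-Cartesian coordinates have no singular set, so geodesics never meet a
boundary in the spatial directions. -/
theorem curvature_denom_pos {d : ℕ} {k : ℝ} (hk : k = 0 ∨ k = -1) (x : Space d) :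
    0 < 1 - k * ‖x‖ ^ 2 := by
  rcases hk with rfl | rfl
  · simp
  · have := sq_nonneg ‖x‖; linarith

/-! ### Geodesics as integral curves of the spray -/

/-- The geodesic spray on positions and velocities. -/
def spray {d : ℕ} (α k : ℝ) (z : Event d × Event d) : Event d × Event d :=
  (z.2, -connection α k z.1 z.2 z.2)

theorem contDiffAt_spray {d : ℕ} {α k : ℝ} (hk : k = 0 ∨ k = -1) {z : Event d × Event d}
    (hz : 0 < z.1.1) : ContDiffAt ℝ 1 (spray α k) z := by
  have h1 : ContDiffAt ℝ 1 (fun z : Event d × Event d => z.1.1) z := by fun_prop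
  have hx : ContDiffAt ℝ 1 (fun z : Event d × Event d => z.1.2) z := by fun_prop
  have ht : ContDiffAt ℝ 1 (fun z : Event d × Event d => z.2.1) z := by fun_prop
  have hu : ContDiffAt ℝ 1 (fun z : Event d × Event d => z.2.2) z := by fun_prop
  have hD : 1 - k * ‖z.1.2‖ ^ 2 ≠ 0 := (curvature_denom_pos hk _).ne'
  have hxu := hx.inner ℝ hu
  have hm : ContDiffAt ℝ 1 (fun z : Event d × Event d => spatialMetric k z.1.2 z.2.2 z.2.2) z :=
    (hu.inner ℝ hu).add ((contDiffAt_const.mul (hxu.mul hxu)).div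
      (contDiffAt_const.sub (contDiffAt_const.mul (hx.norm_sq ℝ))) hD)
  exact (contDiff_snd.contDiffAt).prodMk (((contDiffAt_const.mul
    (h1.rpow_const_of_ne hz.ne')).mul hm).prodMk (((contDiffAt_const.div h1 hz.ne').smul
      ((ht.smul hu).add (ht.smul hu))).add ((contDiffAt_const.mul hm).smul hx))).neg

theorem IsGeodesicOn.hasDerivAt_spray {d : ℕ} {α k : ℝ} (hk : k = 0 ∨ k = -1) {a : ℝ → ℝ}
    (ha : ∀ t, 0 < t → a t = t ^ α) {γ : ℝ → Event d} {J : Set ℝ} (h : IsGeodesicOn a k γ J)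
    {s : ℝ} (hs : s ∈ J) :
    HasDerivAt (fun r => (γ r, deriv γ r)) (spray α k (γ s, deriv γ s)) s := by
  have h2 := (covDeriv_eq_zero_iff ha (h.time_pos s hs) (curvature_denom_pos hk _).ne').1
    (h.equation s hs)
  have := (h.differentiableAt s hs).hasDerivAt.prodMk (h.differentiableAt_deriv s hs).hasDerivAt
  rwa [h2] at this

/-- A geodesic is determined by its initial position and velocity. -/
theorem IsGeodesicOn.eqOn {d : ℕ} {α k : ℝ} (hk : k = 0 ∨ k = -1) {a : ℝ → ℝ}
    (ha : ∀ t, 0 < t → a t = t ^ α) {γ γ' : ℝ → Event d} {J J' S : Set ℝ}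
    (h : IsGeodesicOn a k γ J) (h' : IsGeodesicOn a k γ' J') (hS : IsPreconnected S)
    (hSJ : S ⊆ J) (hSJ' : S ⊆ J') {s₀ : ℝ} (hs₀ : s₀ ∈ S) (h0 : γ s₀ = γ' s₀)
    (h1 : deriv γ s₀ = deriv γ' s₀) : EqOn γ γ' S := by
  have := eqOn_of_hasDerivAt_of_contDiffAt (v := spray α k) (f := fun r => (γ r, deriv γ r))
    (g := fun r => (γ' r, deriv γ' r)) (h.isOpen.inter h'.isOpen) hS (subset_inter hSJ hSJ')
    (fun t ht => contDiffAt_spray hk (h.time_pos t ht.1))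
    (fun t ht => h.hasDerivAt_spray hk ha ht.1) (fun t ht => h'.hasDerivAt_spray hk ha ht.2) hs₀
    (Prod.ext h0 h1)
  exact fun t ht => congrArg Prod.fst (this ht)

/-! ### Parallel frames along the observer -/

/-- A parallel orthonormal frame along the central observer is a fixed isometry divided by the
scale factor. -/
theorem IsFermiFrame.exists_isometry {d : ℕ} {α k : ℝ} {a : ℝ → ℝ}
    (ha : ∀ t, 0 < t → a t = t ^ α) {e : ℝ → Space d →L[ℝ] Event d} (he : IsFermiFrame a k e) :
    ∃ R : Space d ≃ₗᵢ[ℝ] Space d, ∀ τ, 0 < τ → ∀ y, e τ y = (0, (τ ^ α)⁻¹ • R y) := by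
  have hobs : ∀ τ, deriv (observer : ℝ → Event d) τ = (1, 0) := fun τ =>
    ((hasDerivAt_id τ).prodMk (hasDerivAt_const τ (0 : Space d))).deriv
  have hfst : ∀ τ, 0 < τ → ∀ y, (e τ y).1 = 0 := fun τ hτ y => by
    simpa [metric, spatialMetric, hobs] using he.orthogonal τ hτ y
  have hder : ∀ τ, 0 < τ → ∀ y,
      HasDerivAt (fun s => (e s y).2) (-((α / τ) • (e τ y).2)) τ := fun τ hτ y => by
    have h1 := (covDeriv_eq_zero_iff (γ := observer) (Y := fun s => e s y) ha hτ
      (by simp [observer])).1 (he.parallel τ hτ y)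
    have h2 := (he.differentiableAt τ hτ y).hasDerivAt
    rw [h1] at h2
    have h3 := (ContinuousLinearMap.snd ℝ ℝ (Space d)).hasFDerivAt.comp_hasDerivAt τ h2
    simpa [Function.comp_def, connection, hobs, observer, spatialMetric] using h3
  -- Parallel transport reads `Y' = -(α/τ) Y`, so `τ^α Y` is constant. At `τ = 1` the scale factor
  -- is `1`, hence orthonormality there gives a Euclidean isometry.
  have hconst : ∀ τ, 0 < τ → ∀ y, τ ^ α • (e τ y).2 = (e 1 y).2 := fun τ hτ y => by
    have hd : ∀ s ∈ Ioi (0 : ℝ), HasDerivAt (fun s => s ^ α • (e s y).2) 0 s := fun s hs => by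
      have hs : 0 < s := hs
      refine ((hasDerivAt_rpow_const (p := α) (Or.inl hs.ne')).smul (hder s hs y)).congr_deriv ?_
      rw [smul_neg, smul_smul, rpow_sub_one hs.ne']
      rw [neg_add_eq_zero]
      congr 1; ring
    have := isOpen_Ioi.is_const_of_deriv_eq_zero isPreconnected_Ioi
      (fun s hs => (hd s hs).differentiableAt.differentiableWithinAt)
      (fun s hs => (hd s hs).deriv) (mem_Ioi.2 hτ) (mem_Ioi.2 one_pos)
    simpa using this
  let L : Space d →ₗ[ℝ] Space d := (LinearMap.snd ℝ ℝ (Space d)).comp (e 1).toLinearMap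
  have hL : ∀ y z, (inner ℝ (L y) (L z) : ℝ) = inner ℝ y z := fun y z => by
    have := he.orthonormal 1 one_pos y z
    rw [metric, hfst 1 one_pos] at this
    change (inner ℝ (e 1 y).2 (e 1 z).2 : ℝ) = inner ℝ y z
    simpa [observer, spatialMetric, ha 1 one_pos] using this
  let R := (L.isometryOfInner hL).toLinearIsometryEquiv rfl
  refine ⟨R, fun τ hτ y => Prod.ext (hfst τ hτ y) ?_⟩
  have hR : R y = (e 1 y).2 := rfl
  simp only [hR, ← hconst τ hτ y]
  rw [smul_smul, inv_mul_cancel₀ (rpow_pos_of_pos hτ _).ne', one_smul]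

/-! ### The radial function and its inverse -/

/-- The derivative of `radial k` for `k = 0, -1`. -/
def radialDeriv (k χ : ℝ) : ℝ := if k = 0 then 1 else cosh χ

/-- The inverse function of `radial k` for `k = 0, -1`. -/
def radialInv (k r : ℝ) : ℝ := if k = 0 then r else arsinh r

theorem radial_zero_left : radial 0 = id := by funext χ; simp [radial]

theorem radial_neg_one_left : radial (-1) = sinh := by funext χ; norm_num [radial]

theorem hasDerivAt_radial {k : ℝ} (hk : k = 0 ∨ k = -1) (χ : ℝ) :
    HasDerivAt (radial k) (radialDeriv k χ) χ := by
  rcases hk with rfl | rfl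
  · rw [radial_zero_left]; simpa [radialDeriv] using hasDerivAt_id χ
  · rw [radial_neg_one_left]; simpa [radialDeriv] using hasDerivAt_sinh χ

theorem hasDerivAt_radialDeriv {k : ℝ} (hk : k = 0 ∨ k = -1) (χ : ℝ) :
    HasDerivAt (radialDeriv k) (-k * radial k χ) χ := by
  rcases hk with rfl | rfl
  · have : radialDeriv 0 = fun _ => 1 := by funext χ; simp [radialDeriv]
    rw [this]; simpa using hasDerivAt_const χ (1 : ℝ)
  · have : radialDeriv (-1) = cosh := by funext χ; norm_num [radialDeriv]
    rw [this, radial_neg_one_left]; simpa using hasDerivAt_cosh χ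

theorem contDiff_radial {k : ℝ} (hk : k = 0 ∨ k = -1) : ContDiff ℝ ∞ (radial k) := by
  rcases hk with rfl | rfl
  · rw [radial_zero_left]; exact contDiff_id
  · rw [radial_neg_one_left]; exact contDiff_sinh

theorem contDiff_radialInv (k : ℝ) : ContDiff ℝ ∞ (radialInv k) := by
  by_cases hk : k = 0
  · have : radialInv k = id := by funext r; simp [radialInv, hk]
    rw [this]; exact contDiff_id
  · have : radialInv k = arsinh := by funext r; simp [radialInv, hk]
    rw [this]; exact contDiff_arsinh

theorem radialInv_radial {k : ℝ} (hk : k = 0 ∨ k = -1) (χ : ℝ) : radialInv k (radial k χ) = χ := by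
  rcases hk with rfl | rfl <;> norm_num [radialInv, radial]

theorem radial_radialInv {k : ℝ} (hk : k = 0 ∨ k = -1) (r : ℝ) : radial k (radialInv k r) = r := by
  rcases hk with rfl | rfl <;> norm_num [radialInv, radial]

theorem radial_zero {k : ℝ} (hk : k = 0 ∨ k = -1) : radial k 0 = 0 := by
  rcases hk with rfl | rfl <;> norm_num [radial]

theorem radialDeriv_zero {k : ℝ} : radialDeriv k 0 = 1 := by simp [radialDeriv]

theorem radial_pos {k χ : ℝ} (hk : k = 0 ∨ k = -1) (hχ : 0 < χ) : 0 < radial k χ := by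
  rcases hk with rfl | rfl
  · simpa [radial] using hχ
  · rw [radial_neg_one_left]; exact sinh_pos_iff.2 hχ

theorem radialInv_pos {k r : ℝ} (hr : 0 < r) : 0 < radialInv k r := by
  by_cases hk : k = 0
  · simpa [radialInv, hk] using hr
  · simpa [radialInv, hk] using arsinh_pos_iff.2 hr

/-! ### Explicit radial geodesics -/

/-- A curve in the radial direction `n`, parametrized by the angle `θ` of a spacelike geodesic that
is orthogonal to the observer at proper time `τ`. -/
def radialCurve {d : ℕ} (α k τ : ℝ) (n : Space d) (θ : ℝ) : Event d :=
  (τ * cos θ ^ α⁻¹, radial k (τ ^ (1 - α) * α⁻¹ * radialArc α⁻¹ θ) • n)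

/-- The velocity of the geodesic of speed `ρ` that traces `radialCurve`. -/
def radialVelocity {d : ℕ} (α k τ ρ : ℝ) (n : Space d) (θ : ℝ) : Event d :=
  (-(ρ * (sin θ / cos θ)),
    (radialDeriv k (τ ^ (1 - α) * α⁻¹ * radialArc α⁻¹ θ) * (ρ / τ ^ α * (cos θ ^ 2)⁻¹)) • n)

/-- The hypothesis on `ϑ` says that `arc` of the angle grows at the constant rate `αρ/τ`, i.e. that
the speed is `ρ`. Since `a = τ^α cos θ`, the conclusion is the conservation law `a² χ' = ρ τ^α`. -/
theorem hasDerivAt_chi {α τ ρ : ℝ} (hα : 1 < α) (hτ : 0 < τ) {ϑ : ℝ → ℝ} {s : ℝ}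
    (hϑ : ϑ s ∈ Ioo (-(π / 2)) (π / 2))
    (hd : HasDerivAt ϑ (α * ρ / τ * (cos (ϑ s) ^ α⁻¹)⁻¹) s) :
    HasDerivAt (fun s => τ ^ (1 - α) * α⁻¹ * radialArc α⁻¹ (ϑ s))
      (ρ / τ ^ α * (cos (ϑ s) ^ 2)⁻¹) s := by
  have hα0 : 0 < α := by linarith
  have hc := cos_pos_of_mem_Ioo hϑ
  have hP := rpow_pos_of_pos hc α⁻¹
  have hT := rpow_pos_of_pos hτ α
  refine (((hasDerivAt_radialArc (inv_nonneg.2 hα0.le) (inv_lt_one_of_one_lt₀ hα) hϑ).comp s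
    hd).const_mul _).congr_deriv ?_
  have e1 : cos (ϑ s) ^ (α⁻¹ - 2) = cos (ϑ s) ^ α⁻¹ / cos (ϑ s) ^ 2 := by
    rw [rpow_sub hc]; norm_num
  have e2 : τ ^ (1 - α) = τ / τ ^ α := by rw [rpow_sub hτ, rpow_one]
  rw [e1, e2]
  field_simp

theorem hasDerivAt_radialCurve {d : ℕ} {α k τ ρ : ℝ} (hα : 1 < α) (hk : k = 0 ∨ k = -1)
    (hτ : 0 < τ) (n : Space d) {ϑ : ℝ → ℝ} {s : ℝ} (hϑ : ϑ s ∈ Ioo (-(π / 2)) (π / 2))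
    (hd : HasDerivAt ϑ (α * ρ / τ * (cos (ϑ s) ^ α⁻¹)⁻¹) s) :
    HasDerivAt (fun s => radialCurve α k τ n (ϑ s)) (radialVelocity α k τ ρ n (ϑ s)) s := by
  have hα0 : 0 < α := by linarith
  have hc := cos_pos_of_mem_Ioo hϑ
  have hP := rpow_pos_of_pos hc α⁻¹
  have h1 := ((hasDerivAt_cos_rpow (β := α⁻¹) hϑ).comp s hd).const_mul τ
  have h2 := ((hasDerivAt_radial hk _).comp s (hasDerivAt_chi hα hτ hϑ hd)).smul_const n
  refine (h1.prodMk h2).congr_deriv (Prod.ext ?_ rfl)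
  simp only [radialVelocity]
  rw [rpow_sub_one hc.ne']
  field_simp

theorem hasDerivAt_radialVelocity {d : ℕ} {α k τ ρ : ℝ} (hα : 1 < α) (hk : k = 0 ∨ k = -1)
    (hτ : 0 < τ) {n : Space d} (hn : ‖n‖ = 1) {ϑ : ℝ → ℝ} {s : ℝ}
    (hϑ : ϑ s ∈ Ioo (-(π / 2)) (π / 2))
    (hd : HasDerivAt ϑ (α * ρ / τ * (cos (ϑ s) ^ α⁻¹)⁻¹) s) :
    HasDerivAt (fun s => radialVelocity α k τ ρ n (ϑ s))
      (-connection α k (radialCurve α k τ n (ϑ s)) (radialVelocity α k τ ρ n (ϑ s))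
        (radialVelocity α k τ ρ n (ϑ s))) s := by
  have hα0 : 0 < α := by linarith
  have hc := cos_pos_of_mem_Ioo hϑ
  have hP := rpow_pos_of_pos hc α⁻¹
  have hT := rpow_pos_of_pos hτ α
  have hs := (hasDerivAt_sin (ϑ s)).comp s hd
  have hcs := (hasDerivAt_cos (ϑ s)).comp s hd
  have hχ := hasDerivAt_chi hα hτ hϑ hd
  have h1 := ((hs.fun_div hcs hc.ne').const_mul ρ).fun_neg
  have h2 := (((hasDerivAt_radialDeriv hk _).comp s hχ).fun_mul
    (((hcs.fun_pow 2).fun_inv (pow_pos hc 2).ne').const_mul (ρ / τ ^ α))).smul_const n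
  refine (h1.prodMk h2).congr_deriv ?_
  -- The direction is constant (`n' = 0`), so the spatial square length of the velocity is just
  -- `χ'²`.
  have hh := spatialMetric_polar k hk (τ ^ (1 - α) * α⁻¹ * radialArc α⁻¹ (ϑ s)) _
    (ρ / τ ^ α * (cos (ϑ s) ^ 2)⁻¹) (hasDerivAt_radial hk _) n 0 hn (by simp)
  simp only [smul_zero, add_zero, norm_zero] at hh
  -- This is `t^(2α-1) = a(t)²/t` with `a(t) = τ^α cos θ`.
  have e1 : (τ * cos (ϑ s) ^ α⁻¹) ^ (2 * α - 1) =
      (τ ^ α * cos (ϑ s)) ^ 2 / (τ * cos (ϑ s) ^ α⁻¹) := by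
    rw [rpow_sub_one (by positivity), mul_comm 2 α, rpow_mul (by positivity), mul_rpow hτ.le hP.le,
      ← rpow_mul hc.le, inv_mul_cancel₀ hα0.ne', rpow_one]
    norm_num
  refine Prod.ext ?_ ?_
  · simp only [connection, radialCurve, radialVelocity, Prod.fst_neg, hh, e1, Function.comp_apply]
    field_simp
    linear_combination -ρ ^ 2 * sin_sq_add_cos_sq (ϑ s)
  · simp only [connection, radialCurve, radialVelocity, Prod.snd_neg, hh, Function.comp_apply,
      smul_smul, ← add_smul, ← neg_smul]
    congr 1
    generalize radialDeriv k _ = C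
    generalize radial k _ = S
    field_simp
    ring

theorem isGeodesicOn_radialCurve {d : ℕ} {α k τ ρ : ℝ} (hα : 1 < α) (hk : k = 0 ∨ k = -1)
    {a : ℝ → ℝ} (ha : ∀ t, 0 < t → a t = t ^ α)
    (hτ : 0 < τ) {n : Space d} (hn : ‖n‖ = 1) {ϑ : ℝ → ℝ} {J : Set ℝ} (hJ : IsOpen J)
    (hϑ : ∀ s ∈ J, ϑ s ∈ Ioo (-(π / 2)) (π / 2))
    (hd : ∀ s ∈ J, HasDerivAt ϑ (α * ρ / τ * (cos (ϑ s) ^ α⁻¹)⁻¹) s) :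
    IsGeodesicOn a k (fun s => radialCurve α k τ n (ϑ s)) J := by
  have h1 : ∀ s ∈ J, HasDerivAt (fun s => radialCurve α k τ n (ϑ s))
      (radialVelocity α k τ ρ n (ϑ s)) s := fun s hs =>
    hasDerivAt_radialCurve hα hk hτ n (hϑ s hs) (hd s hs)
  have h2 : ∀ s ∈ J, deriv (fun s => radialCurve α k τ n (ϑ s)) =ᶠ[𝓝 s]
      fun s => radialVelocity α k τ ρ n (ϑ s) := fun s hs => by
    filter_upwards [hJ.mem_nhds hs] with r hr using (h1 r hr).deriv
  have h3 : ∀ s ∈ J, HasDerivAt (deriv fun s => radialCurve α k τ n (ϑ s)) _ s := fun s hs =>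
    (hasDerivAt_radialVelocity hα hk hτ hn (hϑ s hs) (hd s hs)).congr_of_eventuallyEq (h2 s hs)
  have h0 : ∀ s ∈ J, 0 < (radialCurve α k τ n (ϑ s)).1 := fun s hs =>
    mul_pos hτ (rpow_pos_of_pos (cos_pos_of_mem_Ioo (hϑ s hs)) _)
  refine ⟨hJ, h0, fun s hs => (h1 s hs).differentiableAt, fun s hs => (h3 s hs).differentiableAt,
    fun s hs => ?_⟩
  refine (covDeriv_eq_zero_iff (γ := fun s => radialCurve α k τ n (ϑ s)) ha (h0 s hs)
    (curvature_denom_pos hk _).ne').2 ?_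
  rw [(h3 s hs).deriv, (h1 s hs).deriv]

/-! ### The Fermi chart and its inverse in the parameters `τ`, `θ` and direction -/

/-- The event with Fermi coordinates `c`, for the frame given by the isometry `R`. -/
def fermiExp {d : ℕ} (α k : ℝ) (R : Space d ≃ₗᵢ[ℝ] Space d) (c : Event d) : Event d :=
  radialCurve α k c.1 (‖c.2‖⁻¹ • R c.2) (arcInv α⁻¹ (α * ‖c.2‖ / c.1))

/-- The range of the Fermi coordinates off the world line. -/
def fermiRange (d : ℕ) (α : ℝ) : Set (Event d) :=
  {c | 0 < c.1 ∧ c.2 ≠ 0 ∧ α * ‖c.2‖ / c.1 < arc α⁻¹ (π / 2)}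

/-- The angle `θ` of an event on the radial geodesic orthogonal to the observer. -/
def angle {d : ℕ} (α k : ℝ) (q : Event d) : ℝ :=
  ratioInv α⁻¹ ((α - 1) * radialInv k ‖q.2‖ * q.1 ^ (α - 1))

/-- The Fermi coordinates of an event, for the frame given by the isometry `R`. -/
def fermiCoords {d : ℕ} (α k : ℝ) (R : Space d ≃ₗᵢ[ℝ] Space d) (q : Event d) : Event d :=
  (q.1 * cos (angle α k q) ^ (-α⁻¹),
    (q.1 * cos (angle α k q) ^ (-α⁻¹) * α⁻¹ * arc α⁻¹ (angle α k q) * ‖q.2‖⁻¹) • R.symm q.2)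

/-- The events inside the horizon, off the world line. -/
def insideHorizon (d : ℕ) (α k : ℝ) : Set (Event d) :=
  {q | 0 < q.1 ∧ q.2 ≠ 0 ∧ (α - 1) * radialInv k ‖q.2‖ * q.1 ^ (α - 1) < 1}

/-- The Fermi coordinates of `radialCurve α k τ (R m) θ`. -/
def polarFermi {d : ℕ} (α τ : ℝ) (m : Space d) (θ : ℝ) : Event d :=
  (τ, (τ * α⁻¹ * arc α⁻¹ θ) • m)

variable {d : ℕ} {α k τ θ : ℝ} {m n : Space d}

/-- Self-similarity: the powers `τ^(1-α)` and `τ^(α-1)` cancel, so the fraction of the horizon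
distance depends on `θ` alone. This decouples the inversion into two one-variable problems. -/
theorem chi_mul_rpow (hα : 1 < α) (hτ : 0 < τ) (hθ : θ ∈ Ioo (-(π / 2)) (π / 2)) :
    (α - 1) * (τ ^ (1 - α) * α⁻¹ * radialArc α⁻¹ θ) * (τ * cos θ ^ α⁻¹) ^ (α - 1) =
      horizonRatio α⁻¹ θ := by
  have hα0 : 0 < α := by linarith
  have hc := cos_pos_of_mem_Ioo hθ
  rw [horizonRatio_eq (inv_lt_one_of_one_lt₀ hα) hθ, mul_rpow hτ.le (rpow_nonneg hc.le _),
    ← rpow_mul hc.le]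
  have e1 : α⁻¹ * (α - 1) = 1 - α⁻¹ := by field_simp
  have e2 : τ ^ (1 - α) * τ ^ (α - 1) = 1 := by rw [← rpow_add hτ]; simp
  rw [e1]
  linear_combination (α - 1) * α⁻¹ * radialArc α⁻¹ θ * cos θ ^ (1 - α⁻¹) * e2 +
    radialArc α⁻¹ θ * cos θ ^ (1 - α⁻¹) * e1

theorem chi_pos (hα : 1 < α) (hτ : 0 < τ) (hθ : θ ∈ Ioo 0 (π / 2)) :
    0 < τ ^ (1 - α) * α⁻¹ * radialArc α⁻¹ θ := by
  have hα0 : 0 < α := by linarith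
  have hβ1 := inv_lt_one_of_one_lt₀ hα
  have hc := cos_pos_of_mem_Ioo (Ioo_zero_subset hθ)
  have h1 := ((bijOn_horizonRatio (inv_nonneg.2 hα0.le) hβ1).mapsTo hθ).1
  rw [← chi_mul_rpow hα hτ (Ioo_zero_subset hθ)] at h1
  have h2 : 0 < (τ * cos θ ^ α⁻¹) ^ (α - 1) := by positivity
  exact pos_of_mul_pos_right (pos_of_mul_pos_left h1 h2.le) (by linarith)

theorem norm_radialCurve_snd (hα : 1 < α) (hk : k = 0 ∨ k = -1) (hτ : 0 < τ)
    (hθ : θ ∈ Ioo 0 (π / 2)) (hn : ‖n‖ = 1) :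
    ‖(radialCurve α k τ n θ).2‖ = radial k (τ ^ (1 - α) * α⁻¹ * radialArc α⁻¹ θ) := by
  rw [radialCurve, norm_smul, hn, mul_one, norm_of_nonneg (radial_pos hk (chi_pos hα hτ hθ)).le]

theorem ratio_radialCurve (hα : 1 < α) (hk : k = 0 ∨ k = -1) (hτ : 0 < τ)
    (hθ : θ ∈ Ioo 0 (π / 2)) (hn : ‖n‖ = 1) :
    (α - 1) * radialInv k ‖(radialCurve α k τ n θ).2‖ * (radialCurve α k τ n θ).1 ^ (α - 1) =
      horizonRatio α⁻¹ θ := by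
  rw [norm_radialCurve_snd hα hk hτ hθ hn, radialInv_radial hk]
  exact chi_mul_rpow hα hτ (Ioo_zero_subset hθ)

theorem radialCurve_mem (hα : 1 < α) (hk : k = 0 ∨ k = -1) (hτ : 0 < τ)
    (hθ : θ ∈ Ioo 0 (π / 2)) (hn : ‖n‖ = 1) : radialCurve α k τ n θ ∈ insideHorizon d α k := by
  refine ⟨mul_pos hτ (rpow_pos_of_pos (cos_pos_of_mem_Ioo (Ioo_zero_subset hθ)) _), ?_, ?_⟩
  · rw [← norm_pos_iff, norm_radialCurve_snd hα hk hτ hθ hn]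
    exact radial_pos hk (chi_pos hα hτ hθ)
  · rw [ratio_radialCurve hα hk hτ hθ hn]
    exact ((bijOn_horizonRatio (inv_nonneg.2 (by linarith)) (inv_lt_one_of_one_lt₀ hα)).mapsTo
      hθ).2

theorem fermiCoords_radialCurve (hα : 1 < α) (hk : k = 0 ∨ k = -1) (hτ : 0 < τ)
    (hθ : θ ∈ Ioo 0 (π / 2)) (hm : ‖m‖ = 1) (R : Space d ≃ₗᵢ[ℝ] Space d) :
    fermiCoords α k R (radialCurve α k τ (R m) θ) = polarFermi α τ m θ := by
  have hn : ‖R m‖ = 1 := by rw [R.norm_map, hm]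
  have hang : angle α k (radialCurve α k τ (R m) θ) = θ := by
    rw [angle, ratio_radialCurve hα hk hτ hθ hn]
    exact ratioInv_horizonRatio (inv_nonneg.2 (by linarith)) (inv_lt_one_of_one_lt₀ hα) hθ
  have hc := cos_pos_of_mem_Ioo (Ioo_zero_subset hθ)
  have ht : (radialCurve α k τ (R m) θ).1 * cos θ ^ (-α⁻¹) = τ := by
    rw [radialCurve, mul_assoc, ← rpow_add hc]; simp
  have hr := radial_pos hk (chi_pos hα hτ hθ)
  rw [fermiCoords, hang, ht, norm_radialCurve_snd hα hk hτ hθ hn, polarFermi]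
  simp only [radialCurve, map_smul, R.symm_apply_apply, smul_smul]
  rw [mul_assoc, inv_mul_cancel₀ hr.ne', mul_one]

theorem norm_polarFermi_snd (hα : 1 < α) (hτ : 0 < τ) (hθ : θ ∈ Ioo 0 (π / 2)) (hm : ‖m‖ = 1) :
    ‖(polarFermi α τ m θ).2‖ = τ * α⁻¹ * arc α⁻¹ θ := by
  have hβ : 0 < α⁻¹ := inv_pos.2 (by linarith)
  have := ((bijOn_arc_pos hβ.le).mapsTo hθ).1
  rw [polarFermi, norm_smul, hm, mul_one, norm_of_nonneg (by positivity)]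

theorem arc_polarFermi (hα : 1 < α) (hτ : 0 < τ) (hθ : θ ∈ Ioo 0 (π / 2)) (hm : ‖m‖ = 1) :
    α * ‖(polarFermi α τ m θ).2‖ / (polarFermi α τ m θ).1 = arc α⁻¹ θ := by
  have hα0 : 0 < α := by linarith
  rw [norm_polarFermi_snd hα hτ hθ hm, polarFermi]
  field_simp

theorem polarFermi_mem (hα : 1 < α) (hτ : 0 < τ) (hθ : θ ∈ Ioo 0 (π / 2)) (hm : ‖m‖ = 1) :
    polarFermi α τ m θ ∈ fermiRange d α := by
  have hβ : 0 < α⁻¹ := inv_pos.2 (by linarith)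
  have h := (bijOn_arc_pos hβ.le).mapsTo hθ
  refine ⟨hτ, ?_, ?_⟩
  · rw [← norm_pos_iff, norm_polarFermi_snd hα hτ hθ hm]
    exact mul_pos (mul_pos hτ hβ) h.1
  · rw [arc_polarFermi hα hτ hθ hm]; exact h.2

theorem fermiExp_polarFermi (hα : 1 < α) (k : ℝ) (hτ : 0 < τ) (hθ : θ ∈ Ioo 0 (π / 2))
    (hm : ‖m‖ = 1) (R : Space d ≃ₗᵢ[ℝ] Space d) :
    fermiExp α k R (polarFermi α τ m θ) = radialCurve α k τ (R m) θ := by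
  have hβ : 0 < α⁻¹ := inv_pos.2 (by linarith)
  have h := ((bijOn_arc_pos hβ.le).mapsTo hθ).1
  have h' : 0 < τ * α⁻¹ * arc α⁻¹ θ := by positivity
  rw [fermiExp, arc_polarFermi hα hτ hθ hm, norm_polarFermi_snd hα hτ hθ hm,
    arcInv_arc hβ.le (Ioo_zero_subset hθ)]
  simp only [polarFermi, map_smul, smul_smul]
  rw [inv_mul_cancel₀ h'.ne', one_smul]

/-- Together with `exists_radialCurve_eq` this reduces both inverse identities to points given by
`τ`, `θ` and a unit vector, where each map is explicit. -/
theorem exists_polarFermi_eq (hα : 1 < α) {c : Event d} (hc : c ∈ fermiRange d α) :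
    ∃ m : Space d, ‖m‖ = 1 ∧ ∃ θ ∈ Ioo 0 (π / 2), c = polarFermi α c.1 m θ := by
  have hα0 : 0 < α := by linarith
  obtain ⟨hτ, hy, hlt⟩ := hc
  have hρ := norm_pos_iff.2 hy
  obtain ⟨θ, hθ, h⟩ := (bijOn_arc_pos (inv_nonneg.2 hα0.le)).surjOn ⟨by positivity, hlt⟩
  refine ⟨‖c.2‖⁻¹ • c.2, by rw [norm_smul, norm_inv, norm_norm, inv_mul_cancel₀ hρ.ne'],
    θ, hθ, Prod.ext rfl ?_⟩
  rw [polarFermi, h, smul_smul]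
  have : c.1 * α⁻¹ * (α * ‖c.2‖ / c.1) * ‖c.2‖⁻¹ = 1 := by field_simp
  rw [this, one_smul]

theorem exists_radialCurve_eq (hα : 1 < α) (hk : k = 0 ∨ k = -1) {q : Event d}
    (hq : q ∈ insideHorizon d α k) :
    ∃ τ, 0 < τ ∧ ∃ n : Space d, ‖n‖ = 1 ∧ ∃ θ ∈ Ioo 0 (π / 2), q = radialCurve α k τ n θ := by
  have hα0 : 0 < α := by linarith
  have hα1 : 0 < α - 1 := by linarith
  obtain ⟨ht, hx, hlt⟩ := hq
  have hr := norm_pos_iff.2 hx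
  have hri := radialInv_pos (k := k) hr
  obtain ⟨θ, hθ, h⟩ := (bijOn_horizonRatio (inv_nonneg.2 hα0.le)
    (inv_lt_one_of_one_lt₀ hα)).surjOn ⟨by positivity, hlt⟩
  have hc := cos_pos_of_mem_Ioo (Ioo_zero_subset hθ)
  have hτ : 0 < q.1 * cos θ ^ (-α⁻¹) := mul_pos ht (rpow_pos_of_pos hc _)
  have ht' : q.1 * cos θ ^ (-α⁻¹) * cos θ ^ α⁻¹ = q.1 := by
    rw [mul_assoc, ← rpow_add hc]; simp
  refine ⟨_, hτ, ‖q.2‖⁻¹ • q.2, by rw [norm_smul, norm_inv, norm_norm, inv_mul_cancel₀ hr.ne'],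
    θ, hθ, Prod.ext ht'.symm ?_⟩
  have h2 := chi_mul_rpow hα hτ (Ioo_zero_subset hθ)
  rw [ht', h] at h2
  have h3 := mul_left_cancel₀ hα1.ne' (mul_right_cancel₀ (rpow_pos_of_pos ht _).ne' h2)
  rw [radialCurve, h3, radial_radialInv hk, smul_smul, mul_inv_cancel₀ hr.ne', one_smul]

theorem fermiExp_spec (hα : 1 < α) (hk : k = 0 ∨ k = -1) (R : Space d ≃ₗᵢ[ℝ] Space d)
    {c : Event d} (hc : c ∈ fermiRange d α) :
    fermiExp α k R c ∈ insideHorizon d α k ∧ fermiCoords α k R (fermiExp α k R c) = c := by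
  obtain ⟨m, hm, θ, hθ, h⟩ := exists_polarFermi_eq hα hc
  have hτ := hc.1
  rw [h, fermiExp_polarFermi hα k hτ hθ hm R]
  exact ⟨radialCurve_mem hα hk hτ hθ (by rw [R.norm_map, hm]),
    fermiCoords_radialCurve hα hk hτ hθ hm R⟩

theorem fermiCoords_spec (hα : 1 < α) (hk : k = 0 ∨ k = -1) (R : Space d ≃ₗᵢ[ℝ] Space d)
    {q : Event d} (hq : q ∈ insideHorizon d α k) :
    fermiCoords α k R q ∈ fermiRange d α ∧ fermiExp α k R (fermiCoords α k R q) = q := by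
  obtain ⟨τ, hτ, n, hn, θ, hθ, rfl⟩ := exists_radialCurve_eq hα hk hq
  obtain ⟨m, rfl⟩ := R.surjective n
  rw [R.norm_map] at hn
  rw [fermiCoords_radialCurve hα hk hτ hθ hn R]
  exact ⟨polarFermi_mem hα hτ hθ hn, fermiExp_polarFermi hα k hτ hθ hn R⟩

/-! ### Openness and smoothness off the world line -/

theorem isOpen_fermiRange (d : ℕ) (α : ℝ) : IsOpen (fermiRange d α) := by
  have hU : IsOpen {c : Event d | 0 < c.1 ∧ c.2 ≠ 0} :=
    (isOpen_lt continuous_const continuous_fst).inter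
      (isOpen_ne_fun continuous_snd continuous_const)
  have hc : ContinuousOn (fun c : Event d => α * ‖c.2‖ / c.1) {c : Event d | 0 < c.1 ∧ c.2 ≠ 0} :=
    (by fun_prop : Continuous fun c : Event d => α * ‖c.2‖).continuousOn.div
      continuous_fst.continuousOn fun c hc => hc.1.ne'
  convert hc.isOpen_inter_preimage hU (isOpen_Iio (a := arc α⁻¹ (π / 2))) using 1
  ext c; simp [fermiRange, and_assoc]

theorem contDiffOn_ratio (d : ℕ) (α k : ℝ) :
    ContDiffOn ℝ ∞ (fun q : Event d => (α - 1) * radialInv k ‖q.2‖ * q.1 ^ (α - 1))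
      {q : Event d | 0 < q.1 ∧ q.2 ≠ 0} := fun q hq => by
  have h1 : ContDiffAt ℝ ∞ (fun q : Event d => q.1 ^ (α - 1)) q :=
    contDiffAt_fst.rpow_const_of_ne hq.1.ne'
  have h2 : ContDiffAt ℝ ∞ (fun q : Event d => ‖q.2‖) q := contDiffAt_snd.norm ℝ hq.2
  exact ((contDiffAt_const.mul ((contDiff_radialInv k).contDiffAt.comp q h2)).mul
    h1).contDiffWithinAt

theorem isOpen_insideHorizon (d : ℕ) (α k : ℝ) : IsOpen (insideHorizon d α k) := by
  have hU : IsOpen {c : Event d | 0 < c.1 ∧ c.2 ≠ 0} :=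
    (isOpen_lt continuous_const continuous_fst).inter
      (isOpen_ne_fun continuous_snd continuous_const)
  have h := (contDiffOn_ratio d α k).continuousOn.isOpen_inter_preimage hU
    (isOpen_Iio (a := (1 : ℝ)))
  have e : _ = insideHorizon d α k := Set.ext fun q => and_assoc
  exact e ▸ h

theorem contDiffOn_fermiCoords (hα : 1 < α) (R : Space d ≃ₗᵢ[ℝ] Space d) :
    ContDiffOn ℝ ∞ (fermiCoords α k R) (insideHorizon d α k) := fun q hq => by
  have hα0 : 0 < α := by linarith
  have hα1 : 0 < α - 1 := by linarith
  have hβ := inv_nonneg.2 hα0.le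
  have hβ1 := inv_lt_one_of_one_lt₀ hα
  have hU : insideHorizon d α k ∈ 𝓝 q := (isOpen_insideHorizon d α k).mem_nhds hq
  obtain ⟨ht, hx, hlt⟩ := hq
  have hri := radialInv_pos (k := k) (norm_pos_iff.2 hx)
  have hmem : (α - 1) * radialInv k ‖q.2‖ * q.1 ^ (α - 1) ∈ Ioo (0 : ℝ) 1 := ⟨by positivity, hlt⟩
  have hratio := ((contDiffOn_ratio d α k).mono fun q hq => ⟨hq.1, hq.2.1⟩).contDiffAt hU
  have hang : ContDiffAt ℝ ∞ (angle (d := d) α k) q :=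
    ((contDiffOn_ratioInv hβ hβ1).contDiffAt (isOpen_Ioo.mem_nhds hmem)).comp q hratio
  have hθ : angle α k q ∈ Ioo (-(π / 2)) (π / 2) := by
    obtain ⟨θ, hθ, h⟩ := (bijOn_horizonRatio hβ hβ1).surjOn hmem
    rw [angle, ← h, ratioInv_horizonRatio hβ hβ1 hθ]
    exact Ioo_zero_subset hθ
  have hcos : ContDiffAt ℝ ∞ (fun q : Event d => cos (angle α k q) ^ (-α⁻¹)) q :=
    (contDiffAt_cos_rpow hθ).comp q hang
  have harc : ContDiffAt ℝ ∞ (fun q : Event d => arc α⁻¹ (angle α k q)) q :=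
    ((contDiffOn_arc hβ).contDiffAt (isOpen_Ioo.mem_nhds hθ)).comp q hang
  have hn : ContDiffAt ℝ ∞ (fun q : Event d => ‖q.2‖⁻¹) q :=
    (contDiffAt_snd.norm ℝ hx).inv (norm_ne_zero_iff.2 hx)
  have hR : ContDiffAt ℝ ∞ (fun q : Event d => R.symm q.2) q :=
    R.symm.contDiff.contDiffAt.comp q contDiffAt_snd
  have hτ := contDiffAt_fst.mul hcos
  exact (hτ.prodMk ((((hτ.mul contDiffAt_const).mul harc).mul hn).smul hR)).contDiffWithinAt

theorem contDiffOn_fermiExp (hα : 1 < α) (hk : k = 0 ∨ k = -1) (R : Space d ≃ₗᵢ[ℝ] Space d) :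
    ContDiffOn ℝ ∞ (fermiExp α k R) (fermiRange d α) := fun c hc => by
  have hα0 : 0 < α := by linarith
  have hβ := inv_nonneg.2 hα0.le
  obtain ⟨hτ, hy, hlt⟩ := hc
  have hρ := norm_pos_iff.2 hy
  have hmem : α * ‖c.2‖ / c.1 ∈ Ioo (-arc α⁻¹ (π / 2)) (arc α⁻¹ (π / 2)) :=
    ⟨(neg_lt_zero.2 (arc_pi_div_two_pos hβ)).trans (by positivity), hlt⟩
  have hnorm : ContDiffAt ℝ ∞ (fun c : Event d => ‖c.2‖) c := contDiffAt_snd.norm ℝ hy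
  have hratio : ContDiffAt ℝ ∞ (fun c : Event d => α * ‖c.2‖ / c.1) c :=
    (contDiffAt_const.mul hnorm).div contDiffAt_fst hτ.ne'
  have hang : ContDiffAt ℝ ∞ (fun c : Event d => arcInv α⁻¹ (α * ‖c.2‖ / c.1)) c :=
    ((contDiffOn_arcInv hβ).contDiffAt (isOpen_Ioo.mem_nhds hmem)).comp c hratio
  have hθ := arcInv_mem hβ hmem
  have hcos : ContDiffAt ℝ ∞ (fun c : Event d => cos (arcInv α⁻¹ (α * ‖c.2‖ / c.1)) ^ α⁻¹) c :=
    ContDiffAt.comp (g := fun θ => cos θ ^ α⁻¹) c (contDiffAt_cos_rpow hθ) hang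
  have harc : ContDiffAt ℝ ∞
      (fun c : Event d => radialArc α⁻¹ (arcInv α⁻¹ (α * ‖c.2‖ / c.1))) c :=
    ContDiffAt.comp (g := radialArc α⁻¹) c
      ((contDiffOn_radialArc hβ).contDiffAt (isOpen_Ioo.mem_nhds hθ)) hang
  have hT : ContDiffAt ℝ ∞ (fun c : Event d => c.1 ^ (1 - α)) c :=
    contDiffAt_fst.rpow_const_of_ne hτ.ne'
  have hrad : ContDiffAt ℝ ∞ (fun c : Event d => radial k
      (c.1 ^ (1 - α) * α⁻¹ * radialArc α⁻¹ (arcInv α⁻¹ (α * ‖c.2‖ / c.1)))) c :=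
    (contDiff_radial hk).contDiffAt.comp c ((hT.mul contDiffAt_const).mul harc)
  have hR : ContDiffAt ℝ ∞ (fun c : Event d => ‖c.2‖⁻¹ • R c.2) c :=
    (hnorm.inv hρ.ne').smul (R.contDiff.contDiffAt.comp c contDiffAt_snd)
  exact ((contDiffAt_fst.mul hcos).prodMk (hrad.smul hR)).contDiffWithinAt

/-! ### Which pairs are Fermi coordinates of which events -/

/-- The geodesic orthogonal to the observer with initial velocity given by the Fermi coordinates
`c`, with the set of parameters on which it exists. -/
theorem exists_geodesic_of_fermi (hα : 1 < α) (hk : k = 0 ∨ k = -1) {a : ℝ → ℝ}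
    (ha : ∀ t, 0 < t → a t = t ^ α) (R : Space d ≃ₗᵢ[ℝ] Space d) {c : Event d} (hτ : 0 < c.1)
    (hy : c.2 ≠ 0) :
    ∃ γ : ℝ → Event d,
      (γ = fun s => radialCurve α k c.1 (‖c.2‖⁻¹ • R c.2) (arcInv α⁻¹ (α * ‖c.2‖ / c.1 * s))) ∧
      IsGeodesicOn a k γ
        {s | α * ‖c.2‖ / c.1 * s ∈ Ioo (-arc α⁻¹ (π / 2)) (arc α⁻¹ (π / 2))} ∧
      γ 0 = observer c.1 ∧ deriv γ 0 = (0, (c.1 ^ α)⁻¹ • R c.2) := by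
  have hα0 : 0 < α := by linarith
  have hβ := inv_nonneg.2 hα0.le
  have hρ := norm_pos_iff.2 hy
  have hn : ‖‖c.2‖⁻¹ • R c.2‖ = 1 := by
    rw [norm_smul, norm_inv, norm_norm, R.norm_map, inv_mul_cancel₀ hρ.ne']
  have hJ : IsOpen {s | α * ‖c.2‖ / c.1 * s ∈ Ioo (-arc α⁻¹ (π / 2)) (arc α⁻¹ (π / 2))} :=
    isOpen_Ioo.preimage (by fun_prop : Continuous fun s : ℝ => α * ‖c.2‖ / c.1 * s)
  have hd : ∀ s ∈ {s | α * ‖c.2‖ / c.1 * s ∈ Ioo (-arc α⁻¹ (π / 2)) (arc α⁻¹ (π / 2))},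
      HasDerivAt (fun s => arcInv α⁻¹ (α * ‖c.2‖ / c.1 * s))
        (α * ‖c.2‖ / c.1 * (cos (arcInv α⁻¹ (α * ‖c.2‖ / c.1 * s)) ^ α⁻¹)⁻¹) s := fun s hs => by
    have h1 : HasDerivAt (fun s => α * ‖c.2‖ / c.1 * s) (α * ‖c.2‖ / c.1) s := by
      simpa using (hasDerivAt_id s).const_mul (α * ‖c.2‖ / c.1)
    exact ((hasDerivAt_arcInv hβ hs).comp s h1).congr_deriv (mul_comm _ _)
  have h00 : arcInv α⁻¹ 0 = 0 := by
    have := arcInv_arc hβ (θ := 0) ⟨by linarith [pi_pos], by linarith [pi_pos]⟩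
    rwa [arc_zero] at this
  have hF := arc_pi_div_two_pos hβ
  have h0J : (0 : ℝ) ∈
      {s | α * ‖c.2‖ / c.1 * s ∈ Ioo (-arc α⁻¹ (π / 2)) (arc α⁻¹ (π / 2))} := by
    simpa using hF
  refine ⟨_, rfl, isGeodesicOn_radialCurve hα hk ha hτ hn hJ (fun s hs => arcInv_mem hβ hs) hd,
    ?_, ?_⟩
  · simp [radialCurve, h00, radialArc_zero, radial_zero hk, observer]
  · have := hasDerivAt_radialCurve (ϑ := fun s => arcInv α⁻¹ (α * ‖c.2‖ / c.1 * s)) hα hk hτ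
      (‖c.2‖⁻¹ • R c.2) (arcInv_mem hβ h0J) (hd 0 h0J)
    rw [this.deriv]
    simp only [radialVelocity, mul_zero, h00, radialArc_zero, radialDeriv_zero, smul_smul]
    simp only [sin_zero, cos_zero, zero_div, mul_zero, neg_zero]
    congr 2
    field_simp

/-- This carries maximality. A competing geodesic agrees with the explicit one as long as the latter
exists; if that were not past parameter `1`, continuity would force `t = 0` at a parameter in `[0,
1]`, which lies outside the spacetime. -/
theorem hasFermiCoords_iff (hα : 1 < α) (hk : k = 0 ∨ k = -1) {a : ℝ → ℝ}
    (ha : ∀ t, 0 < t → a t = t ^ α) {e : ℝ → Space d →L[ℝ] Event d}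
    {R : Space d ≃ₗᵢ[ℝ] Space d} (hR : ∀ τ, 0 < τ → ∀ y, e τ y = (0, (τ ^ α)⁻¹ • R y))
    {q c : Event d} :
    HasFermiCoords a k e q c ↔ c ∈ fermiRange d α ∧ q = fermiExp α k R c := by
  have hα0 : 0 < α := by linarith
  have hβ : 0 < α⁻¹ := inv_pos.2 hα0
  have hF := arc_pi_div_two_pos hβ.le
  constructor
  · rintro ⟨hτ, hy, γ', J', hγ', hJ', h0', h1', rfl⟩
    obtain ⟨γ, hγdef, hγ, h0, h1⟩ := exists_geodesic_of_fermi hα hk ha R hτ hy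
    have hρ := norm_pos_iff.2 hy
    have hv : 0 < α * ‖c.2‖ / c.1 := by positivity
    rw [hR c.1 hτ c.2] at h1'
    have hEq : ∀ s ∈ Icc (0 : ℝ) 1, α * ‖c.2‖ / c.1 * s < arc α⁻¹ (π / 2) → γ' s = γ s :=
        fun s hs hlt => by
      have hsub : Icc 0 s ⊆
          {s | α * ‖c.2‖ / c.1 * s ∈ Ioo (-arc α⁻¹ (π / 2)) (arc α⁻¹ (π / 2))} := fun r hr =>
        ⟨(neg_lt_zero.2 hF).trans_le (mul_nonneg hv.le hr.1),
          (mul_le_mul_of_nonneg_left hr.2 hv.le).trans_lt hlt⟩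
      exact hγ'.eqOn hk ha hγ isPreconnected_Icc ((Icc_subset_Icc_right hs.2).trans hJ') hsub
        (left_mem_Icc.2 hs.1) (h0'.trans h0.symm) (h1'.trans h1.symm) (right_mem_Icc.2 hs.1)
    have hlt : α * ‖c.2‖ / c.1 < arc α⁻¹ (π / 2) := by
      by_contra! hge
      -- the time coordinate of the geodesic tends to `0` at the parameter `S (π / 2) ≤ 1`
      set v := α * ‖c.2‖ / c.1 with hvdef
      let S : ℝ → ℝ := fun θ => arc α⁻¹ θ / v
      have hSc : ContinuousAt S (π / 2) := (hasDerivAt_arc hβ.le _).continuousAt.div_const v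
      have hS1 : S (π / 2) ∈ Icc (0 : ℝ) 1 := ⟨by positivity, (div_le_one hv).2 hge⟩
      have hlim1 : Tendsto (fun θ => (γ' (S θ)).1) (𝓝[<] (π / 2)) (𝓝 (γ' (S (π / 2))).1) := by
        have hc : ContinuousAt (fun θ => γ' (S θ)) (π / 2) :=
          ContinuousAt.comp (f := S) (hγ'.differentiableAt _ (hJ' hS1)).continuousAt hSc
        exact hc.fst.tendsto.mono_left nhdsWithin_le_nhds
      have hlim2 : Tendsto (fun θ => c.1 * cos θ ^ α⁻¹) (𝓝[<] (π / 2)) (𝓝 0) := by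
        have hc : Continuous fun θ => c.1 * cos θ ^ α⁻¹ :=
          continuous_const.mul (continuous_cos.rpow_const fun _ => Or.inr hβ.le)
        have := (hc.tendsto (π / 2)).mono_left (nhdsWithin_le_nhds (s := Iio (π / 2)))
        simpa [zero_rpow hβ.ne', inv_ne_zero hα0.ne'] using this
      have hev : (fun θ => (γ' (S θ)).1) =ᶠ[𝓝[<] (π / 2)] fun θ => c.1 * cos θ ^ α⁻¹ := by
        filter_upwards [Ioo_mem_nhdsLT (by linarith [pi_pos] : (0 : ℝ) < π / 2)] with θ hθ
        have hm := (bijOn_arc_pos hβ.le).mapsTo hθ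
        have e1 : v * S θ = arc α⁻¹ θ := mul_div_cancel₀ _ hv.ne'
        have hS : S θ ∈ Icc (0 : ℝ) 1 :=
          ⟨div_nonneg hm.1.le hv.le, (div_le_one hv).2 (hm.2.le.trans hge)⟩
        rw [hEq _ hS (by rw [e1]; exact hm.2), hγdef]
        simp only [e1, radialCurve, arcInv_arc hβ.le (Ioo_zero_subset hθ)]
      have := tendsto_nhds_unique (hlim1.congr' hev) hlim2
      exact (hγ'.time_pos _ (hJ' hS1)).ne' this
    refine ⟨⟨hτ, hy, hlt⟩, ?_⟩
    rw [hEq 1 (right_mem_Icc.2 zero_le_one) (by rwa [mul_one]), hγdef]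
    simp only [mul_one, fermiExp]
  · rintro ⟨⟨hτ, hy, hlt⟩, rfl⟩
    obtain ⟨γ, hγdef, hγ, h0, h1⟩ := exists_geodesic_of_fermi hα hk ha R hτ hy
    have hv : 0 ≤ α * ‖c.2‖ / c.1 := by positivity
    refine ⟨hτ, hy, γ, _, hγ, fun s hs => ⟨(neg_lt_zero.2 hF).trans_le (mul_nonneg hv hs.1),
      (mul_le_of_le_one_right hv hs.2).trans_lt hlt⟩, h0, ?_, ?_⟩
    · rw [h1, hR c.1 hτ]
    · rw [hγdef]; simp only [mul_one, fermiExp]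

/-! ### Domain and range of the chart, and the theorem -/

theorem eventsOver_regionV (hα : 1 < α) (hk : k = 0 ∨ k = -1) {a : ℝ → ℝ}
    (ha : ∀ t, 0 < t → a t = t ^ α) :
    eventsOver k (regionV a) = insideHorizon d α k := by
  have hα1 : 0 < α - 1 := by linarith
  have key : ∀ t χ : ℝ, 0 < t → (χ < chiHoriz a t ↔ (α - 1) * χ * t ^ (α - 1) < 1) :=
    fun t χ ht => by
    have h : t ^ (1 - α) = (t ^ (α - 1))⁻¹ := by rw [← rpow_neg ht.le]; ring_nf
    have hp := rpow_pos_of_pos ht (α - 1)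
    rw [chiHoriz_of_eq_rpow hα ha ht, h, lt_div_iff₀ hα1, ← one_div, lt_div_iff₀ hp, mul_comm χ]
  ext q
  constructor
  · rintro ⟨χ, n, hn, hq, ht, hχ, hlt⟩
    have hr := radial_pos hk hχ
    have hnorm : ‖q.2‖ = radial k χ := by rw [hq, norm_smul, hn, mul_one, norm_of_nonneg hr.le]
    refine ⟨ht, norm_pos_iff.1 (hnorm ▸ hr), ?_⟩
    rw [hnorm, radialInv_radial hk]
    exact (key _ _ ht).1 hlt
  · rintro ⟨ht, hx, hlt⟩
    have hr := norm_pos_iff.2 hx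
    refine ⟨radialInv k ‖q.2‖, ‖q.2‖⁻¹ • q.2,
      by rw [norm_smul, norm_inv, norm_norm, inv_mul_cancel₀ hr.ne'], ?_, ht, radialInv_pos hr,
      (key _ _ ht).2 hlt⟩
    rw [radial_radialInv hk, smul_smul, mul_inv_cancel₀ hr.ne', one_smul]

theorem setOf_regionU (hα : 1 < α) {a : ℝ → ℝ} (ha : ∀ t, 0 < t → a t = t ^ α) :
    {c : Event d | (c.1, ‖c.2‖) ∈ regionU a} = fermiRange d α := by
  have hα0 : 0 < α := by linarith
  ext c
  refine and_congr_right fun hτ => and_congr norm_pos_iff ?_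
  simp only
  rw [sliceRadius_of_eq_rpow hα ha hτ, div_lt_iff₀ hτ]
  have : c.1 * α⁻¹ * arc α⁻¹ (π / 2) = arc α⁻¹ (π / 2) * c.1 / α := by ring
  rw [this, lt_div_iff₀ hα0, mul_comm ‖c.2‖]

/-- The maximal Fermi chart off the world line. -/
def fermiChart (hα : 1 < α) (hk : k = 0 ∨ k = -1) (R : Space d ≃ₗᵢ[ℝ] Space d) :
    OpenPartialHomeomorph (Event d) (Event d) where
  toFun := fermiCoords α k R
  invFun := fermiExp α k R
  source := insideHorizon d α k
  target := fermiRange d α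
  map_source' _ hq := (fermiCoords_spec hα hk R hq).1
  map_target' _ hc := (fermiExp_spec hα hk R hc).1
  left_inv' _ hq := (fermiCoords_spec hα hk R hq).2
  right_inv' _ hc := (fermiExp_spec hα hk R hc).2
  open_source := isOpen_insideHorizon d α k
  open_target := isOpen_fermiRange d α
  continuousOn_toFun := (contDiffOn_fermiCoords hα R).continuousOn
  continuousOn_invFun := (contDiffOn_fermiExp hα hk R).continuousOn

end

end RW

theorem mainTheorem1 (d : ℕ) (k : ℝ) (hk : k = 0 ∨ k = -1) (α : ℝ) (hα : 1 < α)
    (a : ℝ → ℝ) (ha : ∀ t, 0 < t → a t = t ^ α)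
    (e : ℝ → RW.Space d →L[ℝ] RW.Event d) (he : RW.IsFermiFrame a k e) :
    ∃ Φ : OpenPartialHomeomorph (RW.Event d) (RW.Event d),
      RW.IsFermiChart a k e Φ ∧
      Φ.source = RW.eventsOver k (RW.regionV a) ∧
      Φ.target = {c | (c.1, ‖c.2‖) ∈ RW.regionU a} ∧
      (∀ q c, RW.HasFermiCoords a k e q c → q ∈ Φ.source ∧ c = Φ q) ∧
      (∀ Ψ : OpenPartialHomeomorph (RW.Event d) (RW.Event d), RW.IsFermiChart a k e Ψ →
        Ψ.source ⊆ Φ.source ∧ Ψ.target ⊆ Φ.target ∧ Set.EqOn Ψ Φ Ψ.source) := by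
  obtain ⟨R, hR⟩ := he.exists_isometry ha
  have hmax : ∀ q c, RW.HasFermiCoords a k e q c →
      q ∈ (RW.fermiChart hα hk R).source ∧ c = RW.fermiChart hα hk R q := fun q c h => by
    obtain ⟨hc, rfl⟩ := (RW.hasFermiCoords_iff hα hk ha hR).1 h
    have hs := RW.fermiExp_spec hα hk R hc
    exact ⟨hs.1, hs.2.symm⟩
  refine ⟨RW.fermiChart hα hk R, ⟨RW.contDiffOn_fermiCoords hα R, RW.contDiffOn_fermiExp hα hk R,
    fun q hq => ?_⟩, (RW.eventsOver_regionV hα hk ha).symm, (RW.setOf_regionU hα ha).symm, hmax,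
    fun Ψ hΨ => ?_⟩
  · have hs := RW.fermiCoords_spec hα hk R hq
    exact (RW.hasFermiCoords_iff hα hk ha hR).2 ⟨hs.1, hs.2.symm⟩
  -- Pointwise maximality suffices: the Fermi coordinates of an event off the world line are unique,
  -- so any other chart must agree with `Φ`.
  · have h := fun q hq => hmax q (Ψ q) (hΨ.hasFermiCoords q hq)
    refine ⟨fun q hq => (h q hq).1, fun c hc => ?_, fun q hq => (h q hq).2⟩
    have hq := h _ (Ψ.map_target hc)
    rw [Ψ.right_inv hc] at hq
    rw [hq.2]
    exact (RW.fermiChart hα hk R).map_source hq.1
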